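/- Let $\kappa,\tau\in\mathbb R$ and let $\mathcal N_{\kappa,\tau}=\{(x,y,z)\in\mathbb R^3: B>0\}$, $B=1+\frac{\kappa}{4}(x^2+y^2)$, carry the metric $$g_{\kappa,\tau}=\frac{dx^2+dy^2}{B^2}+\Big(dz+\tau\,\frac{y\,dx-x\,dy}{B}\Big)^2 .$$ Let $a,m,H\in\mathbb R$ with $m\neq0$, let $I$ be a nonempty open interval and $U:I\to(0,\infty)$ a $C^2$ function. Put $\Delta=(1-2a\tau)^2+(m^2U^2-a^2)(4\tau^2-\kappa)$ and assume that on $I$ $$\Delta>0,\qquad q:=\frac{m^2U^2-a^2}{(1+\sqrt\Delta)^2-4\tau^2m^2U^2}>0,\qquad 1+\frac{\kappa}{4}\xi_1^2>0,\quad\text{where }\ \xi_1:=2\sqrt q .$$ A Bour surface of $(U,m,a)$ is a surface given in cylindrical coordinates $(r,\theta,z)$ by $\Psi(u,t)=(\xi_1(u),\theta(u,t),\xi_2(u)+a\,\theta(u,t))$, $(u,t)\in I\times\mathbb R$, with $$\xi_2(u)=\int\frac{m\,U\,(4+\kappa\xi_1^2)}{4\xi_1^2}\,\rho\,du,\qquad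 \theta(u,t)=\frac tm+\int\frac{(4\tau-a\kappa)\xi_1^2-4a}{4m\,U\,\xi_1^2}\,\rho\,du,$$ where the integrals are indefinite integrals and $\rho\in C^1(I)$ is a branch of the square root $$\rho^2=\xi_1^2-\frac{m^4U^2U'^2(4+\kappa\xi_1^2)^2}{16\,\Delta}.$$ Mean curvature means the sum of the principal curvatures, with respect to the unit normal $n$ such that $(\Psi_u,\Psi_t,n)$ is positively oriented in $\mathbb R^3$. For $c\in\mathbb R$ put $$\begin{aligned} b&=(1-2a\tau)[\kappa(1+2a\tau)-8\tau^2]-c^2, & b_1&=4\tau^2-2a\kappa\tau-cH, & b_2&=-\frac{b}{2b_1},\\ b_3&=4a\tau-a^2\kappa-1, & c_1&=1+(1-2a\tau)^2-cH, & c_2&=-c^2-4a^2(1-a\tau)^2,\end{aligned}$$ and $d=b_1^2+b(H^2+\kappa)$. Say that $U$ has the form $U_c$ if for some $u_0\in\mathbb R$ and all $u\in I$, with $s=u-u_0$: 1. if $\kappa=\tau=H=0$: $\displaystyle U^2=\frac{s^2+a^2+c^2/4}{m^2}$; 2. if $\kappa=4\tau^2\neq-H^2$: $c_1^2+c_2(H^2+4\tau^2)\ge0$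 and $\displaystyle U^2=\frac{c_1+\sqrt{c_1^2+c_2(H^2+4\tau^2)}\,\sin(\sqrt{4\tau^2+H^2}\,s)}{m^2(H^2+4\tau^2)}$; 3. if $-H^2=\kappa\neq4\tau^2$: $b_1\neq0$, $\frac{b_1}{2}s^2+b_2>0$ and $\displaystyle U^2=\frac{\big(\frac{b_1}{2}s^2+b_2\big)^2+b_3}{m^2(4\tau^2+H^2)}$; 4. if $-H^2<\kappa\neq4\tau^2$: $d\ge0$, $S:=b_1+\sqrt d\,\sin(\sqrt{H^2+\kappa}\,s)>0$ and $\displaystyle U^2=\frac{(H^2+\kappa)^2b_3+S^2}{m^2(4\tau^2-\kappa)(H^2+\kappa)^2}$; 5. if $-H^2>\kappa\neq4\tau^2$: $d\neq0$, $\displaystyle U^2=\frac{(H^2+\kappa)^2b_3+S^2}{m^2(4\tau^2-\kappa)(H^2+\kappa)^2}$ and $S<0$, where $S=b_1-\sqrt{-d}\,\sinh(\sqrt{-(H^2+\kappa)}\,s)$ if $d<0$ and $S=b_1-\sqrt{d}\,\cosh(\sqrt{-(H^2+\kappa)}\,s)$ if $d>0$. Then: (i) a Bour surface of $(U,m,a)$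 is a $C^2$ immersed surface in $\mathcal N_{\kappa,\tau}$ with constant mean curvature $H$, for one of its two unit normals (that is, constant mean curvature $H$ or $-H$ with respect to $n$), if and only if $U$ has the form $U_c$ for some $c\in\mathbb R$; (ii) for every $c\in\mathbb R$, if $U$ has the form $U_c$, then for some branch $\rho$ a Bour surface of $(U,m,a)$ has constant mean curvature exactly $H$ with respect to $n$. So, for each $H$, the functions $U_c$ form a one-parameter family giving helicoidal surfaces of constant mean curvature $H$. -/

import Mathlib

noncomputable section

namespace BCV

/-! ### The Bianchi-Cartan-Vranceanu spaces -/

/-- The function `B = 1 + (κ/4)(x² + y²)` at the point `p = (x, y, z)`. -/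
def conf (κ : ℝ) (p : Fin 3 → ℝ) : ℝ := 1 + κ / 4 * (p 0 ^ 2 + p 1 ^ 2)

/-- The open subset of `ℝ³` on which the metric is defined. -/
def space (κ : ℝ) : Set (Fin 3 → ℝ) := {p | 0 < conf κ p}

/-- The metric `(dx² + dy²)/B² + (dz + τ (y dx - x dy)/B)²` at the point `p`,
evaluated on the tangent vectors `v` and `w`. -/
def metric (κ τ : ℝ) (p v w : Fin 3 → ℝ) : ℝ :=
  (v 0 * w 0 + v 1 * w 1) / conf κ p ^ 2 +
    (v 2 + τ * (p 1 * v 0 - p 0 * v 1) / conf κ p) *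
      (w 2 + τ * (p 1 * w 0 - p 0 * w 1) / conf κ p)

/-- `g(∇_V W, N)` at `p` for the Levi-Civita connection, where `V`, `W`, `N` are the vector fields
with constant coordinates `v`, `w`, `n` (Koszul's formula; the brackets vanish).  For coordinate
vectors these are the Christoffel symbols of the first kind. -/
def christoffel (κ τ : ℝ) (p v w n : Fin 3 → ℝ) : ℝ :=
  (fderiv ℝ (fun q => metric κ τ q w n) p v + fderiv ℝ (fun q => metric κ τ q v n) p w
    - fderiv ℝ (fun q => metric κ τ q v w) p n) / 2

/-! ### Mean curvature of a parametrized surface `Ψ (u, t)` -/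

/-- The partial derivative `Ψ_u`. -/
def du (Ψ : ℝ → ℝ → Fin 3 → ℝ) (u t : ℝ) : Fin 3 → ℝ := deriv (fun x => Ψ x t) u

/-- The partial derivative `Ψ_t`. -/
def dt (Ψ : ℝ → ℝ → Fin 3 → ℝ) (u t : ℝ) : Fin 3 → ℝ := deriv (fun x => Ψ u x) t

/-- The coefficient `g(∇_{v} w, n)` of the second fundamental form, for `v = Ψ_i`, `w = Ψ_j` and
`d = Ψ_ij`, with respect to the normal vector `n`. -/
def secondForm (κ τ : ℝ) (p v w d n : Fin 3 → ℝ) : ℝ :=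
  metric κ τ p d n + christoffel κ τ p v w n

/-- The mean curvature (trace of the second fundamental form with respect to the first one, i.e.
the sum of the principal curvatures) of `Ψ` at `(u, t)`, with respect to the unit normal `n`. -/
def meanCurvature (κ τ : ℝ) (Ψ : ℝ → ℝ → Fin 3 → ℝ) (n : Fin 3 → ℝ) (u t : ℝ) : ℝ :=
  let p := Ψ u t
  let v := du Ψ u t
  let w := dt Ψ u t
  (metric κ τ p v v * secondForm κ τ p w w (dt (dt Ψ) u t) n
    - 2 * metric κ τ p v w * secondForm κ τ p v w (du (dt Ψ) u t) n
    + metric κ τ p w w * secondForm κ τ p v v (du (du Ψ) u t) n) /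
  (metric κ τ p v v * metric κ τ p w w - metric κ τ p v w ^ 2)

/-- `n` is the unit normal of `Ψ` at `(u, t)` for which `(Ψ_u, Ψ_t, n)` is a positive basis.  Such an
`n` exists exactly where `Ψ` is regular, and it is then unique. -/
structure IsPosUnitNormal (κ τ : ℝ) (Ψ : ℝ → ℝ → Fin 3 → ℝ) (u t : ℝ) (n : Fin 3 → ℝ) : Prop where
  unit : metric κ τ (Ψ u t) n n = 1
  normal_u : metric κ τ (Ψ u t) (du Ψ u t) n = 0
  normal_t : metric κ τ (Ψ u t) (dt Ψ u t) n = 0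
  pos : 0 < (Matrix.of ![du Ψ u t, dt Ψ u t, n]).det

/-- On `I × ℝ` the map `Ψ` is a `C²` immersion into the BCV-space, and its mean curvature with respect
to the unit normal that makes `(Ψ_u, Ψ_t, n)` a positive basis is the constant `H`. -/
structure HasMeanCurvature (κ τ : ℝ) (Ψ : ℝ → ℝ → Fin 3 → ℝ) (I : Set ℝ) (H : ℝ) : Prop where
  contDiffOn : ContDiffOn ℝ 2 (fun q : ℝ × ℝ => Ψ q.1 q.2) (I ×ˢ Set.univ)
  mem_space : ∀ u ∈ I, ∀ t : ℝ, Ψ u t ∈ space κ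
  mean_eq : ∀ u ∈ I, ∀ t : ℝ, ∃ n : Fin 3 → ℝ,
    IsPosUnitNormal κ τ Ψ u t n ∧ meanCurvature κ τ Ψ n u t = H

/-! ### The Bour formulas -/

/-- `Δ = (1 - 2aτ)² + (m²U² - a²)(4τ² - κ)`. -/
def bourDelta (κ τ a m : ℝ) (U : ℝ → ℝ) (u : ℝ) : ℝ :=
  (1 - 2 * a * τ) ^ 2 + (m ^ 2 * U u ^ 2 - a ^ 2) * (4 * τ ^ 2 - κ)

/-- The quotient under the square root in the formula for `ξ₁`. -/
def bourQuot (κ τ a m : ℝ) (U : ℝ → ℝ) (u : ℝ) : ℝ :=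
  (m ^ 2 * U u ^ 2 - a ^ 2) /
    ((1 + √(bourDelta κ τ a m U u)) ^ 2 - 4 * τ ^ 2 * m ^ 2 * U u ^ 2)

/-- The first profile function `ξ₁`. -/
def xi1 (κ τ a m : ℝ) (U : ℝ → ℝ) (u : ℝ) : ℝ := 2 * √(bourQuot κ τ a m U u)

/-- The radicand `ξ₁² - m⁴ U² U'² (4 + κ ξ₁²)² / (16 Δ)` in the formulas for `ξ₂` and `θ`. -/
def bourRadicand (κ τ a m : ℝ) (U : ℝ → ℝ) (u : ℝ) : ℝ :=
  xi1 κ τ a m U u ^ 2 -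
    m ^ 4 * U u ^ 2 * deriv U u ^ 2 * (4 + κ * xi1 κ τ a m U u ^ 2) ^ 2 /
      (16 * bourDelta κ τ a m U u)

/-- `U` is a positive `C²` function on `I`, and the formula for `ξ₁` makes sense there: `Δ > 0`,
the quotient under the root is positive, and the points at distance `ξ₁` from the axis lie in the
BCV-space. -/
structure IsBourAdmissible (κ τ a m : ℝ) (I : Set ℝ) (U : ℝ → ℝ) : Prop where
  contDiffOn : ContDiffOn ℝ 2 U I
  pos : ∀ u ∈ I, 0 < U u
  delta_pos : ∀ u ∈ I, 0 < bourDelta κ τ a m U u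
  quot_pos : ∀ u ∈ I, 0 < bourQuot κ τ a m U u
  conf_pos : ∀ u ∈ I, 0 < 1 + κ / 4 * xi1 κ τ a m U u ^ 2

/-- `ξ₂` and `ϑ` are given by the Bour formulas: they are indefinite integrals of the expressions below,
where `ρ` is a (continuously differentiable branch of the) square root of the radicand. -/
structure IsBourProfile (κ τ a m : ℝ) (I : Set ℝ) (U ρ ξ₂ ϑ : ℝ → ℝ) : Prop where
  contDiffOn : ContDiffOn ℝ 1 ρ I
  sq_eq : ∀ u ∈ I, ρ u ^ 2 = bourRadicand κ τ a m U u
  deriv_xi2 : ∀ u ∈ I, HasDerivAt ξ₂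
    (m * U u * (4 + κ * xi1 κ τ a m U u ^ 2) / (4 * xi1 κ τ a m U u ^ 2) * ρ u) u
  deriv_theta : ∀ u ∈ I, HasDerivAt ϑ
    (((4 * τ - a * κ) * xi1 κ τ a m U u ^ 2 - 4 * a) / (4 * m * U u * xi1 κ τ a m U u ^ 2) * ρ u) u

/-- The helicoidal surface `(ξ₁(u), θ(u,t), ξ₂(u) + a θ(u,t))`, `θ(u,t) = t/m + ϑ(u)`, given in
cylindrical coordinates and written here in Cartesian ones. -/
def bourSurface (κ τ a m : ℝ) (U ξ₂ ϑ : ℝ → ℝ) (u t : ℝ) : Fin 3 → ℝ :=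
  ![xi1 κ τ a m U u * Real.cos (t / m + ϑ u),
    xi1 κ τ a m U u * Real.sin (t / m + ϑ u),
    ξ₂ u + a * (t / m + ϑ u)]

/-! ### The explicit functions -/

def cstB (κ τ a c : ℝ) : ℝ := (1 - 2 * a * τ) * (κ * (1 + 2 * a * τ) - 8 * τ ^ 2) - c ^ 2

def cstB1 (κ τ a H c : ℝ) : ℝ := 4 * τ ^ 2 - 2 * a * κ * τ - c * H

def cstB2 (κ τ a H c : ℝ) : ℝ := -cstB κ τ a c / (2 * cstB1 κ τ a H c)

def cstB3 (κ τ a : ℝ) : ℝ := 4 * a * τ - a ^ 2 * κ - 1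

def cstC1 (τ a H c : ℝ) : ℝ := 1 + (1 - 2 * a * τ) ^ 2 - c * H

def cstC2 (τ a c : ℝ) : ℝ := -c ^ 2 - 4 * a ^ 2 * (1 - a * τ) ^ 2

/-- The number `b₁² + b (H² + κ)`. -/
def disc (κ τ a H c : ℝ) : ℝ := cstB1 κ τ a H c ^ 2 + cstB κ τ a c * (H ^ 2 + κ)

/-- On `I`, the square of `U` is given by the explicit expression with the constant `c`, the origin of
the parameter being `u₀`.  Real radicals are required to be real.  When `κ ≠ 4τ²` the quantity that is
squared in the formula is `√Δ` (up to the factor `H² + κ`), and its sign is required accordingly. -/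
def IsExplicit (κ τ a m H c u₀ : ℝ) (I : Set ℝ) (U : ℝ → ℝ) : Prop :=
  (κ = 0 ∧ τ = 0 ∧ H = 0 ∧
    ∀ u ∈ I, U u ^ 2 = ((u - u₀) ^ 2 + a ^ 2 + c ^ 2 / 4) / m ^ 2) ∨
  (κ = 4 * τ ^ 2 ∧ κ ≠ -H ^ 2 ∧ 0 ≤ cstC1 τ a H c ^ 2 + cstC2 τ a c * (H ^ 2 + 4 * τ ^ 2) ∧
    ∀ u ∈ I, U u ^ 2 =
      (cstC1 τ a H c + √(cstC1 τ a H c ^ 2 + cstC2 τ a c * (H ^ 2 + 4 * τ ^ 2)) *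
        Real.sin (√(4 * τ ^ 2 + H ^ 2) * (u - u₀))) / (m ^ 2 * (H ^ 2 + 4 * τ ^ 2))) ∨
  (κ = -H ^ 2 ∧ κ ≠ 4 * τ ^ 2 ∧ cstB1 κ τ a H c ≠ 0 ∧
    ∀ u ∈ I, 0 < cstB1 κ τ a H c / 2 * (u - u₀) ^ 2 + cstB2 κ τ a H c ∧
      U u ^ 2 =
        ((cstB1 κ τ a H c / 2 * (u - u₀) ^ 2 + cstB2 κ τ a H c) ^ 2 + cstB3 κ τ a) /
          (m ^ 2 * (4 * τ ^ 2 + H ^ 2))) ∨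
  (-H ^ 2 < κ ∧ κ ≠ 4 * τ ^ 2 ∧ 0 ≤ disc κ τ a H c ∧
    ∀ u ∈ I,
      0 < cstB1 κ τ a H c + √(disc κ τ a H c) * Real.sin (√(H ^ 2 + κ) * (u - u₀)) ∧
      U u ^ 2 =
        ((H ^ 2 + κ) ^ 2 * cstB3 κ τ a +
          (cstB1 κ τ a H c + √(disc κ τ a H c) * Real.sin (√(H ^ 2 + κ) * (u - u₀))) ^ 2) /
          (m ^ 2 * (4 * τ ^ 2 - κ) * (H ^ 2 + κ) ^ 2)) ∨
  (κ < -H ^ 2 ∧ κ ≠ 4 * τ ^ 2 ∧ disc κ τ a H c < 0 ∧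
    ∀ u ∈ I,
      cstB1 κ τ a H c - √(-disc κ τ a H c) * Real.sinh (√(-(H ^ 2 + κ)) * (u - u₀)) < 0 ∧
      U u ^ 2 =
        ((H ^ 2 + κ) ^ 2 * cstB3 κ τ a +
          (cstB1 κ τ a H c - √(-disc κ τ a H c) * Real.sinh (√(-(H ^ 2 + κ)) * (u - u₀))) ^ 2) /
          (m ^ 2 * (4 * τ ^ 2 - κ) * (H ^ 2 + κ) ^ 2)) ∨
  (κ < -H ^ 2 ∧ κ ≠ 4 * τ ^ 2 ∧ 0 < disc κ τ a H c ∧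
    ∀ u ∈ I,
      cstB1 κ τ a H c - √(disc κ τ a H c) * Real.cosh (√(-(H ^ 2 + κ)) * (u - u₀)) < 0 ∧
      U u ^ 2 =
        ((H ^ 2 + κ) ^ 2 * cstB3 κ τ a +
          (cstB1 κ τ a H c - √(disc κ τ a H c) * Real.cosh (√(-(H ^ 2 + κ)) * (u - u₀))) ^ 2) /
          (m ^ 2 * (4 * τ ^ 2 - κ) * (H ^ 2 + κ) ^ 2))

end BCV

end

/-! The surface is invariant under the flow of the Killing field `∂_θ + a ∂_z`. The Bour formulas
are natural parameters for it: the curves `t = const` have unit speed and are orthogonal to the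
orbits, and `mU` is, up to sign, the length of the Killing field. Everything is expressed through `y
= ξ₁² / B` (`radial`), in which the data become polynomial: with `α = 1 - 2aτ` and `β = 4τ² - κ`,
`√Δ = α + β y / 2` and `m²U² - a² = α y + β y² / 4`.

Let `p`, `s` be the cosine and sine of the angle between the profile and the radial direction. In an
orthonormal frame the mean curvature is `p s' - s p' + s (1 - κξ₁²/4) / ξ₁`; neither the pitch nor
`τ` survives (`meanCurvature_eq`). Put `P = (ξ₁/B) p = y'/2` and `W = (ξ₁/B) s = ρ/B`. Then `P² + W²
= y - κy²/4`, and this constraint, differentiated, together with the curvature equation is a linear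
system for `(W', P')` with determinant `P² + W² > 0`. It gives `W' = H y'/2`, so `W = k + H y/2` for
a constant `k`, the flux. What remains is `y'' = 2 - 2Hk - (H² + κ) y` with a prescribed energy
(`IsFlux`), whose solutions are quadratic, sinusoidal or hyperbolic cosines according to the sign of
`H² + κ`. Substituting them into the formula for `m²U²` gives the functions `U_c`, with `c` affine
in `k`.

Conversely, the explicit formula recovers `y` from `U²` (the sign condition on `S` selects the
positive root `√Δ`), and `y` solves the flux equations. For a given branch this determines only `W²
= (k + H y/2)²`, so the mean curvature is `±H` at each point; continuity and connectedness of `I`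
make the sign constant. The branch `ρ = B (k + H y/2)` gives exactly `H`. -/

noncomputable section

/-! ### Cylindrical components: metric, its derivatives, orientation. -/

namespace BCV

/-- The vector with radial component `x`, angular component `y` and vertical component `z` in the
orthonormal cylindrical frame at the angle `φ`. -/
def cyl (φ x y z : ℝ) : Fin 3 → ℝ :=
  ![x * Real.cos φ - y * Real.sin φ, x * Real.sin φ + y * Real.cos φ, z]

theorem exists_cyl (φ : ℝ) (n : Fin 3 → ℝ) : ∃ x y z, n = cyl φ x y z := by
  refine ⟨n 0 * Real.cos φ + n 1 * Real.sin φ, -n 0 * Real.sin φ + n 1 * Real.cos φ, n 2, ?_⟩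
  have h := Real.sin_sq_add_cos_sq φ
  ext i
  fin_cases i
  · simp only [cyl]
    simp
    linear_combination (-n 0) * h
  · simp only [cyl]
    simp
    linear_combination (-n 1) * h
  · simp [cyl]

/-- The horizontal frame turns with `φ`, so `e_r' = φ' e_φ` and `e_φ' = -φ' e_r`; this accounts for
the two cross terms. -/
theorem hasDerivAt_cyl {φ f g h : ℝ → ℝ} {φ' f' g' h' x : ℝ} (hφ : HasDerivAt φ φ' x)
    (hf : HasDerivAt f f' x) (hg : HasDerivAt g g' x) (hh : HasDerivAt h h' x) :
    HasDerivAt (fun x => cyl (φ x) (f x) (g x) (h x))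
      (cyl (φ x) (f' - g x * φ') (g' + f x * φ') h') x := by
  rw [hasDerivAt_pi]
  intro i
  fin_cases i
  · refine ((hf.mul hφ.cos).sub (hg.mul hφ.sin)).congr_deriv ?_
    simp [cyl]
    ring
  · refine ((hf.mul hφ.sin).add (hg.mul hφ.cos)).congr_deriv ?_
    simp [cyl]
    ring
  · exact hh.congr_deriv (by simp [cyl])

theorem conf_cyl (κ φ r z : ℝ) : conf κ (cyl φ r 0 z) = 1 + κ / 4 * r ^ 2 := by
  have h := Real.sin_sq_add_cos_sq φ
  have e0 : cyl φ r 0 z 0 = r * Real.cos φ := by simp [cyl]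
  have e1 : cyl φ r 0 z 1 = r * Real.sin φ := by simp [cyl]
  rw [conf, e0, e1]
  linear_combination (κ / 4 * r ^ 2) * h

theorem metric_cyl (κ τ φ r z v₀ v₁ v₂ w₀ w₁ w₂ : ℝ) :
    metric κ τ (cyl φ r 0 z) (cyl φ v₀ v₁ v₂) (cyl φ w₀ w₁ w₂) =
      (v₀ * w₀ + v₁ * w₁) / (1 + κ / 4 * r ^ 2) ^ 2 +
        (v₂ - τ * r * v₁ / (1 + κ / 4 * r ^ 2)) * (w₂ - τ * r * w₁ / (1 + κ / 4 * r ^ 2)) := by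
  have h := Real.sin_sq_add_cos_sq φ
  rw [metric, conf_cyl]
  set B := 1 + κ / 4 * r ^ 2
  have e1 : cyl φ v₀ v₁ v₂ 0 * cyl φ w₀ w₁ w₂ 0 + cyl φ v₀ v₁ v₂ 1 * cyl φ w₀ w₁ w₂ 1 =
      v₀ * w₀ + v₁ * w₁ := by
    simp [cyl]
    linear_combination (v₀ * w₀ + v₁ * w₁) * h
  have e2 : ∀ x y t : ℝ, cyl φ r 0 z 1 * cyl φ x y t 0 - cyl φ r 0 z 0 * cyl φ x y t 1 =
      -(r * y) := by
    intro x y t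
    simp [cyl]
    linear_combination (-r * y) * h
  have e3 : ∀ x y t : ℝ, cyl φ x y t 2 = t := by
    intro x y t
    simp [cyl]
  rw [e1, e2, e2, e3, e3]
  ring

theorem hasFDerivAt_conf (κ : ℝ) (p n : Fin 3 → ℝ) :
    DifferentiableAt ℝ (conf κ) p ∧
      fderiv ℝ (conf κ) p n = κ / 2 * (p 0 * n 0 + p 1 * n 1) := by
  have h : HasFDerivAt (conf κ) ((κ / 4) • (((2 * p 0) • ContinuousLinearMap.proj (R := ℝ)
      (φ := fun _ : Fin 3 => ℝ) 0) + ((2 * p 1) • ContinuousLinearMap.proj (R := ℝ)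
      (φ := fun _ : Fin 3 => ℝ) 1))) p := by
    have h0 := (hasFDerivAt_apply (𝕜 := ℝ) (0 : Fin 3) p).pow 2
    have h1 := (hasFDerivAt_apply (𝕜 := ℝ) (1 : Fin 3) p).pow 2
    have := ((h0.add h1).const_mul (κ / 4)).const_add 1
    refine HasFDerivAt.congr_fderiv this ?_
    ext v
    simp
  refine ⟨h.differentiableAt, ?_⟩
  rw [h.fderiv]
  simp
  ring

/-- The directional derivative of a coefficient of the metric. -/
theorem fderiv_metric (κ τ : ℝ) (p v w n : Fin 3 → ℝ) (hp : conf κ p ≠ 0) :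
    fderiv ℝ (fun q => metric κ τ q v w) p n =
      -2 * (v 0 * w 0 + v 1 * w 1) * (κ / 2 * (p 0 * n 0 + p 1 * n 1)) / conf κ p ^ 3 +
      (τ * (n 1 * v 0 - n 0 * v 1) / conf κ p - τ * (p 1 * v 0 - p 0 * v 1) *
        (κ / 2 * (p 0 * n 0 + p 1 * n 1)) / conf κ p ^ 2) *
          (w 2 + τ * (p 1 * w 0 - p 0 * w 1) / conf κ p) +
      (v 2 + τ * (p 1 * v 0 - p 0 * v 1) / conf κ p) *
      (τ * (n 1 * w 0 - n 0 * w 1) / conf κ p - τ * (p 1 * w 0 - p 0 * w 1) *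
        (κ / 2 * (p 0 * n 0 + p 1 * n 1)) / conf κ p ^ 2) := by
  obtain ⟨hd, hf⟩ := hasFDerivAt_conf κ p n
  -- reduce to a derivative along the line through `p` with direction `n`
  have hline : HasDerivAt (fun s : ℝ => p + s • n) n 0 := by
    simpa using ((hasDerivAt_id (0 : ℝ)).smul_const n).const_add p
  have hcoord : ∀ i, HasDerivAt (fun s : ℝ => (p + s • n) i) (n i) 0 := fun i =>
    (hasDerivAt_pi.1 hline) i
  have hc : HasDerivAt (fun s : ℝ => conf κ (p + s • n)) (κ / 2 * (p 0 * n 0 + p 1 * n 1)) 0 := by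
    rw [← hf]
    have : HasFDerivAt (conf κ) (fderiv ℝ (conf κ) p) (p + (0 : ℝ) • n) := by
      simpa using hd.hasFDerivAt
    exact this.comp_hasDerivAt 0 hline
  have hc0 : conf κ (p + (0 : ℝ) • n) ≠ 0 := by simpa using hp
  have hη : ∀ v : Fin 3 → ℝ, HasDerivAt (fun s : ℝ => v 2 + τ * ((p + s • n) 1 * v 0 -
      (p + s • n) 0 * v 1) / conf κ (p + s • n))
      (τ * (n 1 * v 0 - n 0 * v 1) / conf κ p - τ * (p 1 * v 0 - p 0 * v 1) *
        (κ / 2 * (p 0 * n 0 + p 1 * n 1)) / conf κ p ^ 2) 0 := by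
    intro v
    refine ((((((hcoord 1).mul_const (v 0)).sub ((hcoord 0).mul_const (v 1))).const_mul τ).div hc
      hc0).const_add (v 2)).congr_deriv ?_
    simp only [Pi.sub_apply, zero_smul, add_zero]
    field_simp
  have hm := (((hasDerivAt_const (0 : ℝ) (v 0 * w 0 + v 1 * w 1)).div (hc.pow 2)
    (pow_ne_zero 2 hc0))).add ((hη v).mul (hη w))
  have hdm : DifferentiableAt ℝ (fun q => metric κ τ q v w) p := by
    unfold metric
    have hB := hd
    fun_prop (disch := first | exact hp | exact pow_ne_zero 2 hp)
  have h2 : HasDerivAt (fun s : ℝ => metric κ τ (p + s • n) v w)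
      (fderiv ℝ (fun q => metric κ τ q v w) p n) 0 := by
    have : HasFDerivAt (fun q => metric κ τ q v w) (fderiv ℝ (fun q => metric κ τ q v w) p)
        (p + (0 : ℝ) • n) := by
      simpa using hdm.hasFDerivAt
    exact this.comp_hasDerivAt 0 hline
  have h3 := h2.unique hm
  rw [h3]
  simp only [Pi.pow_apply, zero_smul, add_zero]
  field_simp
  ring

/-- The directional derivative of a coefficient of the metric in cylindrical components. -/
theorem fderiv_metric_cyl (κ τ φ r z v₀ v₁ v₂ w₀ w₁ w₂ n₀ n₁ n₂ : ℝ)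
    (hp : 1 + κ / 4 * r ^ 2 ≠ 0) :
    fderiv ℝ (fun q => metric κ τ q (cyl φ v₀ v₁ v₂) (cyl φ w₀ w₁ w₂)) (cyl φ r 0 z)
      (cyl φ n₀ n₁ n₂) =
      -2 * (v₀ * w₀ + v₁ * w₁) * (κ / 2 * (r * n₀)) / (1 + κ / 4 * r ^ 2) ^ 3 +
      (τ * (n₁ * v₀ - n₀ * v₁) / (1 + κ / 4 * r ^ 2) + τ * r * v₁ *
        (κ / 2 * (r * n₀)) / (1 + κ / 4 * r ^ 2) ^ 2) *
          (w₂ - τ * r * w₁ / (1 + κ / 4 * r ^ 2)) +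
      (v₂ - τ * r * v₁ / (1 + κ / 4 * r ^ 2)) *
      (τ * (n₁ * w₀ - n₀ * w₁) / (1 + κ / 4 * r ^ 2) + τ * r * w₁ *
        (κ / 2 * (r * n₀)) / (1 + κ / 4 * r ^ 2) ^ 2) := by
  have h := Real.sin_sq_add_cos_sq φ
  have e1 : ∀ x y t x' y' t' : ℝ, cyl φ x y t 0 * cyl φ x' y' t' 0 +
      cyl φ x y t 1 * cyl φ x' y' t' 1 = x * x' + y * y' := by
    intro x y t x' y' t'
    simp [cyl]
    linear_combination (x * x' + y * y') * h
  have e2 : ∀ x y t x' y' t' : ℝ, cyl φ x y t 1 * cyl φ x' y' t' 0 -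
      cyl φ x y t 0 * cyl φ x' y' t' 1 = y * x' - x * y' := by
    intro x y t x' y' t'
    simp [cyl]
    linear_combination (y * x' - x * y') * h
  have e3 : ∀ x y t : ℝ, cyl φ x y t 2 = t := by
    intro x y t
    simp [cyl]
  rw [fderiv_metric _ _ _ _ _ _ (by rwa [conf_cyl]), conf_cyl]
  simp only [e1, e2, e3]
  ring

theorem det_cyl (φ v₀ v₁ v₂ w₀ w₁ w₂ n₀ n₁ n₂ : ℝ) :
    (Matrix.of ![cyl φ v₀ v₁ v₂, cyl φ w₀ w₁ w₂, cyl φ n₀ n₁ n₂]).det =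
      n₀ * (v₁ * w₂ - v₂ * w₁) + n₁ * (v₂ * w₀ - v₀ * w₂) + n₂ * (v₀ * w₁ - v₁ * w₀) := by
  have h := Real.sin_sq_add_cos_sq φ
  rw [Matrix.det_fin_three]
  simp [cyl]
  linear_combination (n₀ * (v₁ * w₂ - v₂ * w₁) + n₁ * (v₂ * w₀ - v₀ * w₂) +
    n₂ * (v₀ * w₁ - v₁ * w₀)) * h

end BCV

/-! ### The orthonormal frame and the covariant acceleration. -/

namespace BCV

/-- The tangent vector with the components `x`, `y`, `z` in the orthonormal frame of the BCV-space
at the point with cylindrical coordinates `r`, `φ` (and any height). -/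
def frame (κ τ φ r x y z : ℝ) : Fin 3 → ℝ :=
  cyl φ ((1 + κ / 4 * r ^ 2) * x) ((1 + κ / 4 * r ^ 2) * y) (z + τ * r * y)

theorem exists_frame (κ τ φ r : ℝ) (hB : 1 + κ / 4 * r ^ 2 ≠ 0) (n : Fin 3 → ℝ) :
    ∃ x y z, n = frame κ τ φ r x y z := by
  obtain ⟨x, y, z, rfl⟩ := exists_cyl φ n
  refine ⟨x / (1 + κ / 4 * r ^ 2), y / (1 + κ / 4 * r ^ 2),
    z - τ * r * (y / (1 + κ / 4 * r ^ 2)), ?_⟩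
  rw [frame, mul_div_cancel₀ _ hB, mul_div_cancel₀ _ hB, sub_add_cancel]

theorem metric_frame (κ τ φ r z x₀ x₁ x₂ y₀ y₁ y₂ : ℝ) (hB : 1 + κ / 4 * r ^ 2 ≠ 0) :
    metric κ τ (cyl φ r 0 z) (frame κ τ φ r x₀ x₁ x₂) (frame κ τ φ r y₀ y₁ y₂) =
      x₀ * y₀ + x₁ * y₁ + x₂ * y₂ := by
  rw [frame, frame, metric_cyl]
  generalize 1 + κ / 4 * r ^ 2 = B at *
  field_simp
  ring

theorem det_frame (κ τ φ r x₀ x₁ x₂ y₀ y₁ y₂ n₀ n₁ n₂ : ℝ) :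
    (Matrix.of ![frame κ τ φ r x₀ x₁ x₂, frame κ τ φ r y₀ y₁ y₂,
      frame κ τ φ r n₀ n₁ n₂]).det = (1 + κ / 4 * r ^ 2) ^ 2 *
      (n₀ * (x₁ * y₂ - x₂ * y₁) + n₁ * (x₂ * y₀ - x₀ * y₂) + n₂ * (x₀ * y₁ - x₁ * y₀)) := by
  rw [frame, frame, frame, det_cyl]
  ring

/-- If `γ = (r, φ, z)` in cylindrical coordinates and `γ'` has the frame components `x₀, x₁, x₂`, this
is the second derivative of `γ`; here `d₀, d₁, d₂` are the derivatives of the frame components. -/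
def accel (κ τ φ r x₀ x₁ d₀ d₁ d₂ : ℝ) : Fin 3 → ℝ :=
  cyl φ
    ((1 + κ / 4 * r ^ 2) * (κ / 2 * r * x₀ ^ 2 + d₀ - (1 + κ / 4 * r ^ 2) * x₁ ^ 2 / r))
    ((1 + κ / 4 * r ^ 2) * (κ / 2 * r * x₀ * x₁ + d₁ + (1 + κ / 4 * r ^ 2) * x₀ * x₁ / r))
    (d₂ + τ * ((1 + κ / 4 * r ^ 2) * x₀) * x₁ + τ * r * d₁)

/-- The normal component of the covariant acceleration of a curve, in terms of its frame
components. -/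
theorem secondForm_accel (κ τ φ r z x₀ x₁ x₂ d₀ d₁ d₂ n₀ n₁ n₂ : ℝ)
    (hB : 1 + κ / 4 * r ^ 2 ≠ 0) (hr : r ≠ 0) :
    secondForm κ τ (cyl φ r 0 z) (frame κ τ φ r x₀ x₁ x₂) (frame κ τ φ r x₀ x₁ x₂)
      (accel κ τ φ r x₀ x₁ d₀ d₁ d₂) (frame κ τ φ r n₀ n₁ n₂) =
      n₀ * d₀ + n₁ * d₁ + n₂ * d₂ + (x₁ * n₀ - x₀ * n₁) *
        (2 * τ * x₂ - (1 - κ / 4 * r ^ 2) / r * x₁) := by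
  rw [secondForm, christoffel]
  simp only [frame, accel]
  rw [fderiv_metric_cyl _ _ _ _ _ _ _ _ _ _ _ _ _ _ hB,
    fderiv_metric_cyl _ _ _ _ _ _ _ _ _ _ _ _ _ _ hB, metric_cyl]
  obtain ⟨B, hBd⟩ : ∃ B, B = 1 + κ / 4 * r ^ 2 := ⟨_, rfl⟩
  -- Eliminating `κ` leaves an identity of rational functions in the independent variables `B` and
  -- `r`.
  have hκ : κ = 4 * (B - 1) / r ^ 2 := by
    rw [hBd]
    field_simp
    ring
  rw [← hBd] at hB ⊢
  rw [hκ]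
  field_simp
  ring

theorem hasDerivAt_frame_curve {κ τ : ℝ} {φ r z x₀ x₁ x₂ : ℝ → ℝ} {x : ℝ} (hr : r x ≠ 0)
    (hr' : HasDerivAt r ((1 + κ / 4 * r x ^ 2) * x₀ x) x)
    (hφ' : HasDerivAt φ ((1 + κ / 4 * r x ^ 2) * x₁ x / r x) x)
    (hz' : HasDerivAt z (x₂ x + τ * r x * x₁ x) x) :
    HasDerivAt (fun x => cyl (φ x) (r x) 0 (z x)) (frame κ τ (φ x) (r x) (x₀ x) (x₁ x) (x₂ x)) x := by
  refine (hasDerivAt_cyl hφ' hr' (hasDerivAt_const x 0) hz').congr_deriv ?_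
  rw [frame]
  congr 1
  · ring
  · field_simp
    ring

theorem hasDerivAt_frame {κ τ : ℝ} {φ r x₀ x₁ x₂ : ℝ → ℝ} {x d₀ d₁ d₂ : ℝ} (hr : r x ≠ 0)
    (hr' : HasDerivAt r ((1 + κ / 4 * r x ^ 2) * x₀ x) x)
    (hφ' : HasDerivAt φ ((1 + κ / 4 * r x ^ 2) * x₁ x / r x) x)
    (h₀ : HasDerivAt x₀ d₀ x) (h₁ : HasDerivAt x₁ d₁ x) (h₂ : HasDerivAt x₂ d₂ x) :
    HasDerivAt (fun x => frame κ τ (φ x) (r x) (x₀ x) (x₁ x) (x₂ x))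
      (accel κ τ (φ x) (r x) (x₀ x) (x₁ x) d₀ d₁ d₂) x := by
  have hB := ((hr'.pow 2).const_mul (κ / 4)).const_add 1
  refine (hasDerivAt_cyl hφ' (hB.mul h₀) (hB.mul h₁)
    (h₂.add ((hr'.const_mul τ).mul h₁))).congr_deriv ?_
  simp only [Pi.mul_apply, Pi.pow_apply]
  rw [accel]
  congr 1
  · field_simp
    ring
  · field_simp
    ring
  · ring

end BCV

/-! ### Mean curvature of helicoidal surfaces in natural parameters. -/

namespace BCV

/-- The helicoidal surface with radius `r`, and with height `ξ` and angle `ϑ` along the profile. -/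
def helicoid (a m : ℝ) (r ξ ϑ : ℝ → ℝ) (u t : ℝ) : Fin 3 → ℝ :=
  cyl (t / m + ϑ u) (r u) 0 (ξ u + a * (t / m + ϑ u))

/-- The vertical component of the Killing field that generates the helicoidal motions. -/
def pitch (κ τ a : ℝ) (r : ℝ → ℝ) (u : ℝ) : ℝ := a - τ * r u ^ 2 / (1 + κ / 4 * r u ^ 2)

/-- A helicoidal surface whose profile curves `t = const` are orthogonal to the orbits and have unit speed,
the cosine and sine of the angle between the profile and the radial direction being `p` and `s`, and
`|ω|` being the length of the Killing field. -/
structure IsNaturalHelicoid (κ τ a m : ℝ) (I : Set ℝ) (r p s ω ξ ϑ : ℝ → ℝ) : Prop where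
  isOpen : IsOpen I
  r_pos : ∀ u ∈ I, 0 < r u
  conf_pos : ∀ u ∈ I, 0 < 1 + κ / 4 * r u ^ 2
  deriv_r : ∀ u ∈ I, HasDerivAt r ((1 + κ / 4 * r u ^ 2) * p u) u
  sq_add_sq : ∀ u ∈ I, p u ^ 2 + s u ^ 2 = 1
  diff_p : ∀ u ∈ I, DifferentiableAt ℝ p u
  diff_s : ∀ u ∈ I, DifferentiableAt ℝ s u
  diff_ω : ∀ u ∈ I, DifferentiableAt ℝ ω u
  ω_pos : ∀ u ∈ I, 0 < ω u / m
  ω_sq : ∀ u ∈ I, ω u ^ 2 = (r u / (1 + κ / 4 * r u ^ 2)) ^ 2 + pitch κ τ a r u ^ 2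
  deriv_ξ : ∀ u ∈ I, HasDerivAt ξ (ω u * (1 + κ / 4 * r u ^ 2) * s u / r u) u
  deriv_ϑ : ∀ u ∈ I, HasDerivAt ϑ
    ((1 + κ / 4 * r u ^ 2) * (-(s u * (pitch κ τ a r u / ω u))) / r u) u

/-- A unit vector orthogonal to two orthogonal directions is determined by its orientation. -/
theorem normal_unique {p s f g U n₀ n₁ n₂ : ℝ} (hps : p ^ 2 + s ^ 2 = 1) (hfg : f ^ 2 + g ^ 2 = 1)
    (hU : 0 < U) (hv : p * n₀ + -(s * f) * n₁ + s * g * n₂ = 0)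
    (hw : 0 * n₀ + g * U * n₁ + f * U * n₂ = 0) (hn : n₀ * n₀ + n₁ * n₁ + n₂ * n₂ = 1)
    (hpos : 0 < -s * n₀ + -(p * f) * n₁ + p * g * n₂) :
    n₀ = -s ∧ n₁ = -(p * f) ∧ n₂ = p * g := by
  have hw' : g * n₁ + f * n₂ = 0 := by
    have : U * (g * n₁ + f * n₂) = 0 := by linear_combination hw
    rcases mul_eq_zero.1 this with h | h
    · exact absurd h hU.ne'
    · exact h
  -- `l` is the component of `n` along the expected normal. Orthogonality makes `n` equal to `l`
  -- times that vector, unit length gives `l² = 1`, and the orientation gives `l = 1`.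
  set l := -s * n₀ + -(p * f) * n₁ + p * g * n₂ with hl
  have h0 : n₀ = l * -s := by rw [hl]; linear_combination p * hv - n₀ * hps
  have hq : f * n₁ - g * n₂ = -(p * l) := by
    rw [hl]; linear_combination (-s) * hv - (f * n₁ - g * n₂) * hps
  have h1 : n₁ = l * -(p * f) := by linear_combination f * hq + g * hw' - n₁ * hfg
  have h2 : n₂ = l * (p * g) := by linear_combination -g * hq + f * hw' - n₂ * hfg
  have hl2 : l ^ 2 = 1 := by
    rw [h0, h1, h2] at hn
    linear_combination hn - l ^ 2 * hps - l ^ 2 * p ^ 2 * hfg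
  have hl1 : l = 1 := by nlinarith
  rw [hl1, one_mul] at h0 h1 h2
  exact ⟨h0, h1, h2⟩

namespace IsNaturalHelicoid

variable {κ τ a m : ℝ} {I : Set ℝ} {r p s ω ξ ϑ : ℝ → ℝ}

theorem ω_ne (h : IsNaturalHelicoid κ τ a m I r p s ω ξ ϑ) {u : ℝ} (hu : u ∈ I) : ω u ≠ 0 := by
  intro h0
  have := h.ω_pos u hu
  rw [h0, zero_div] at this
  exact lt_irrefl _ this

theorem du_eq (h : IsNaturalHelicoid κ τ a m I r p s ω ξ ϑ) {u : ℝ} (hu : u ∈ I) (t : ℝ) :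
    du (helicoid a m r ξ ϑ) u t = frame κ τ (t / m + ϑ u) (r u) (p u)
      (-(s u * (pitch κ τ a r u / ω u))) (s u * (r u / (1 + κ / 4 * r u ^ 2) / ω u)) := by
  have hr := (h.r_pos u hu).ne'
  have hω := h.ω_ne hu
  have hB := (h.conf_pos u hu).ne'
  refine HasDerivAt.deriv (hasDerivAt_frame_curve
    (x₁ := fun u => -(s u * (pitch κ τ a r u / ω u)))
    (x₂ := fun u => s u * (r u / (1 + κ / 4 * r u ^ 2) / ω u)) hr (h.deriv_r u hu)
    ((h.deriv_ϑ u hu).const_add (t / m))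
    (((h.deriv_ξ u hu).add (((h.deriv_ϑ u hu).const_add (t / m)).const_mul a)).congr_deriv ?_))
  -- The vertical components agree precisely because `ω² = (r/B)² + pitch²`.
  have hsq := h.ω_sq u hu
  rw [pitch] at *
  generalize 1 + κ / 4 * r u ^ 2 = B at *
  field_simp
  field_simp at hsq
  linear_combination (s u) * hsq

theorem dt_eq (h : IsNaturalHelicoid κ τ a m I r p s ω ξ ϑ) {u : ℝ} (hu : u ∈ I) (t : ℝ) :
    dt (helicoid a m r ξ ϑ) u t = frame κ τ (t / m + ϑ u) (r u) 0
      (r u / (1 + κ / 4 * r u ^ 2) / m) (pitch κ τ a r u / m) := by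
  have hr := (h.r_pos u hu).ne'
  have hB := (h.conf_pos u hu).ne'
  have hm : m ≠ 0 := by
    rintro rfl
    have := h.ω_pos u hu
    simp at this
  have hφ : HasDerivAt (fun t => t / m + ϑ u) (1 / m) t :=
    ((hasDerivAt_id t).div_const m).add_const _
  refine HasDerivAt.deriv (hasDerivAt_frame_curve (x₀ := fun _ => 0)
    (x₁ := fun _ => r u / (1 + κ / 4 * r u ^ 2) / m)
    (x₂ := fun _ => pitch κ τ a r u / m) (r := fun _ => r u) hr
    ((hasDerivAt_const t (r u)).congr_deriv (by ring)) (hφ.congr_deriv ?_)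
    (((hφ.const_mul a).const_add (ξ u)).congr_deriv ?_))
  · rw [← mul_div_assoc, mul_div_cancel₀ _ hB]
    field_simp
  · rw [pitch]
    field_simp
    ring

theorem dt_dt_eq (h : IsNaturalHelicoid κ τ a m I r p s ω ξ ϑ) {u : ℝ} (hu : u ∈ I) (t : ℝ) :
    dt (dt (helicoid a m r ξ ϑ)) u t = accel κ τ (t / m + ϑ u) (r u) 0
      (r u / (1 + κ / 4 * r u ^ 2) / m) 0 0 0 := by
  have hr := (h.r_pos u hu).ne'
  have hB := (h.conf_pos u hu).ne'
  have hm : m ≠ 0 := by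
    rintro rfl
    have := h.ω_pos u hu
    simp at this
  have hφ : HasDerivAt (fun t => t / m + ϑ u) (1 / m) t :=
    ((hasDerivAt_id t).div_const m).add_const _
  rw [dt, funext (fun t => h.dt_eq hu t)]
  refine HasDerivAt.deriv (hasDerivAt_frame (x₀ := fun _ => 0)
    (x₁ := fun _ => r u / (1 + κ / 4 * r u ^ 2) / m)
    (x₂ := fun _ => pitch κ τ a r u / m) (r := fun _ => r u) hr
    ((hasDerivAt_const t (r u)).congr_deriv (by ring)) (hφ.congr_deriv ?_)
    (hasDerivAt_const _ _) (hasDerivAt_const _ _) (hasDerivAt_const _ _))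
  rw [← mul_div_assoc, mul_div_cancel₀ _ hB]
  field_simp

theorem diff_pitch (h : IsNaturalHelicoid κ τ a m I r p s ω ξ ϑ) {u : ℝ} (hu : u ∈ I) :
    DifferentiableAt ℝ (pitch κ τ a r) u := by
  have hB := (h.conf_pos u hu).ne'
  have := (h.deriv_r u hu).differentiableAt
  unfold pitch
  fun_prop (disch := exact hB)

theorem diff_orbit (h : IsNaturalHelicoid κ τ a m I r p s ω ξ ϑ) {u : ℝ} (hu : u ∈ I) :
    DifferentiableAt ℝ (fun u => r u / (1 + κ / 4 * r u ^ 2) / ω u) u := by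
  have hB := (h.conf_pos u hu).ne'
  have := (h.deriv_r u hu).differentiableAt
  have := h.diff_ω u hu
  have := h.ω_ne hu
  fun_prop (disch := assumption)

theorem du_du_eq (h : IsNaturalHelicoid κ τ a m I r p s ω ξ ϑ) {u : ℝ} (hu : u ∈ I) (t : ℝ) :
    du (du (helicoid a m r ξ ϑ)) u t = accel κ τ (t / m + ϑ u) (r u) (p u)
      (-(s u * (pitch κ τ a r u / ω u))) (deriv p u)
      (-(deriv s u * (pitch κ τ a r u / ω u) +
        s u * deriv (fun u => pitch κ τ a r u / ω u) u))
      (deriv s u * (r u / (1 + κ / 4 * r u ^ 2) / ω u) +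
        s u * deriv (fun u => r u / (1 + κ / 4 * r u ^ 2) / ω u) u) := by
  have hr := (h.r_pos u hu).ne'
  have hev : (fun x => du (helicoid a m r ξ ϑ) x t) =ᶠ[nhds u] fun u =>
      frame κ τ (t / m + ϑ u) (r u) (p u)
      (-(s u * (pitch κ τ a r u / ω u))) (s u * (r u / (1 + κ / 4 * r u ^ 2) / ω u)) := by
    filter_upwards [h.isOpen.mem_nhds hu] with x hx using h.du_eq hx t
  rw [du, hev.deriv_eq]
  refine HasDerivAt.deriv (hasDerivAt_frame hr (h.deriv_r u hu)
    ((h.deriv_ϑ u hu).const_add (t / m)) (h.diff_p u hu).hasDerivAt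
    (((h.diff_s u hu).hasDerivAt.mul
      ((h.diff_pitch hu).div (h.diff_ω u hu) (h.ω_ne hu)).hasDerivAt).neg)
    ((h.diff_s u hu).hasDerivAt.mul (h.diff_orbit hu).hasDerivAt))

/-- The two quotients are the vertical and angular frame components, up to a common sign, of the
unit Killing direction. -/
theorem sq_add_sq_orbit (h : IsNaturalHelicoid κ τ a m I r p s ω ξ ϑ) {u : ℝ} (hu : u ∈ I) :
    (pitch κ τ a r u / ω u) ^ 2 + (r u / (1 + κ / 4 * r u ^ 2) / ω u) ^ 2 = 1 := by
  have hω := h.ω_ne hu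
  rw [div_pow, div_pow _ (ω u), ← add_div, div_eq_one_iff_eq (pow_ne_zero 2 hω), h.ω_sq u hu]
  ring

/-- Obtained by differentiating `f² + g² = 1`. It is all that the mean curvature needs to know about
the derivatives of the Killing direction. -/
theorem deriv_orbit (h : IsNaturalHelicoid κ τ a m I r p s ω ξ ϑ) {u : ℝ} (hu : u ∈ I) :
    (pitch κ τ a r u / ω u) * deriv (fun u => pitch κ τ a r u / ω u) u +
      (r u / (1 + κ / 4 * r u ^ 2) / ω u) *
        deriv (fun u => r u / (1 + κ / 4 * r u ^ 2) / ω u) u = 0 := by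
  have hev : (fun u => (pitch κ τ a r u / ω u) ^ 2 + (r u / (1 + κ / 4 * r u ^ 2) / ω u) ^ 2)
      =ᶠ[nhds u] fun _ => (1 : ℝ) := by
    filter_upwards [h.isOpen.mem_nhds hu] with x hx using h.sq_add_sq_orbit hx
  have h1 := ((((h.diff_pitch hu).div (h.diff_ω u hu) (h.ω_ne hu)).hasDerivAt.pow 2).add
    ((h.diff_orbit hu).hasDerivAt.pow 2)).congr_of_eventuallyEq hev.symm
  have h2 := h1.unique (hasDerivAt_const u (1 : ℝ))
  simp only [Pi.div_apply] at h2
  have e : deriv (pitch κ τ a r / ω) u = deriv (fun u => pitch κ τ a r u / ω u) u := rfl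
  rw [e] at h2
  norm_num at h2
  linear_combination h2 / 2

/-- The unit normal that makes `(Ψ_u, Ψ_t, n)` a positive basis. -/
def normal (κ τ a m : ℝ) (r p s ω ϑ : ℝ → ℝ) (u t : ℝ) : Fin 3 → ℝ :=
  frame κ τ (t / m + ϑ u) (r u) (-s u) (-(p u * (pitch κ τ a r u / ω u)))
    (p u * (r u / (1 + κ / 4 * r u ^ 2) / ω u))

theorem dt_eq' (h : IsNaturalHelicoid κ τ a m I r p s ω ξ ϑ) {u : ℝ} (hu : u ∈ I) (t : ℝ) :
    dt (helicoid a m r ξ ϑ) u t = frame κ τ (t / m + ϑ u) (r u) 0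
      (r u / (1 + κ / 4 * r u ^ 2) / ω u * (ω u / m)) (pitch κ τ a r u / ω u * (ω u / m)) := by
  rw [h.dt_eq hu, div_mul_div_cancel₀ (h.ω_ne hu), div_mul_div_cancel₀ (h.ω_ne hu)]

theorem isPosUnitNormal_iff (h : IsNaturalHelicoid κ τ a m I r p s ω ξ ϑ) {u : ℝ} (hu : u ∈ I)
    (t : ℝ) (n : Fin 3 → ℝ) :
    IsPosUnitNormal κ τ (helicoid a m r ξ ϑ) u t n ↔ n = normal κ τ a m r p s ω ϑ u t := by
  have hB := h.conf_pos u hu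
  have hfg := h.sq_add_sq_orbit hu
  have hps := h.sq_add_sq u hu
  have hU := h.ω_pos u hu
  have hdu := h.du_eq hu t
  have hdt := h.dt_eq' hu t
  constructor
  · rintro ⟨h1, h2, h3, h4⟩
    obtain ⟨n₀, n₁, n₂, rfl⟩ := exists_frame κ τ (t / m + ϑ u) (r u) hB.ne' n
    rw [helicoid, metric_frame _ _ _ _ _ _ _ _ _ _ _ hB.ne'] at h1
    rw [hdu, helicoid, metric_frame _ _ _ _ _ _ _ _ _ _ _ hB.ne'] at h2
    rw [hdt, helicoid, metric_frame _ _ _ _ _ _ _ _ _ _ _ hB.ne'] at h3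
    rw [hdu, hdt, det_frame, mul_pos_iff_of_pos_left (pow_pos hB 2)] at h4
    rw [normal]
    generalize pitch κ τ a r u / ω u = f at *
    generalize r u / (1 + κ / 4 * r u ^ 2) / ω u = g at *
    generalize ω u / m = V at *
    have h5 : 0 < V * (-s u * n₀ + -(p u * f) * n₁ + p u * g * n₂) :=
      h4.trans_eq (by linear_combination (-s u * n₀ * V) * hfg)
    rw [mul_pos_iff_of_pos_left hU] at h5
    obtain ⟨rfl, rfl, rfl⟩ := normal_unique hps hfg hU h2 h3 h1 h5
    rfl
  · rintro rfl
    refine ⟨?_, ?_, ?_, ?_⟩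
    · rw [helicoid, normal, metric_frame _ _ _ _ _ _ _ _ _ _ _ hB.ne']
      linear_combination hps + p u ^ 2 * hfg
    · rw [hdu, helicoid, normal, metric_frame _ _ _ _ _ _ _ _ _ _ _ hB.ne']
      linear_combination p u * s u * hfg
    · rw [hdt, helicoid, normal, metric_frame _ _ _ _ _ _ _ _ _ _ _ hB.ne']
      ring
    · rw [hdu, hdt, normal, det_frame]
      refine mul_pos (pow_pos hB 2) ?_
      refine hU.trans_eq ?_
      linear_combination (-(ω u / m)) * hps - (ω u / m) * (s u ^ 2 + p u ^ 2) * hfg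

/-- The first fundamental form is diagonal, `du² + (ω/m)² dt²`. The `τ`-terms of the two normal
curvatures are opposite, and the remaining dependence on the pitch enters through `f² + g² = 1`. -/
theorem meanCurvature_eq (h : IsNaturalHelicoid κ τ a m I r p s ω ξ ϑ) {u : ℝ} (hu : u ∈ I)
    (t : ℝ) :
    meanCurvature κ τ (helicoid a m r ξ ϑ) (normal κ τ a m r p s ω ϑ u t) u t =
      p u * deriv s u - s u * deriv p u + s u * (1 - κ / 4 * r u ^ 2) / r u := by
  have hB := (h.conf_pos u hu).ne'
  have hr := (h.r_pos u hu).ne'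
  have hfg := h.sq_add_sq_orbit hu
  have hd := h.deriv_orbit hu
  have hps := h.sq_add_sq u hu
  have hU := (h.ω_pos u hu).ne'
  have hω := h.ω_ne hu
  have hE : metric κ τ (helicoid a m r ξ ϑ u t) (du (helicoid a m r ξ ϑ) u t)
      (du (helicoid a m r ξ ϑ) u t) = 1 := by
    rw [h.du_eq hu, helicoid, metric_frame _ _ _ _ _ _ _ _ _ _ _ hB]
    linear_combination hps + s u ^ 2 * hfg
  -- Since this coefficient vanishes, the mixed second derivative never has to be computed.
  have hF : metric κ τ (helicoid a m r ξ ϑ u t) (du (helicoid a m r ξ ϑ) u t)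
      (dt (helicoid a m r ξ ϑ) u t) = 0 := by
    rw [h.du_eq hu, h.dt_eq' hu, helicoid, metric_frame _ _ _ _ _ _ _ _ _ _ _ hB]
    ring
  have hG : metric κ τ (helicoid a m r ξ ϑ u t) (dt (helicoid a m r ξ ϑ) u t)
      (dt (helicoid a m r ξ ϑ) u t) = (ω u / m) ^ 2 := by
    rw [h.dt_eq' hu, helicoid, metric_frame _ _ _ _ _ _ _ _ _ _ _ hB]
    linear_combination (ω u / m) ^ 2 * hfg
  have e₁ : r u / (1 + κ / 4 * r u ^ 2) / m =
      r u / (1 + κ / 4 * r u ^ 2) / ω u * (ω u / m) := (div_mul_div_cancel₀ hω).symm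
  have e₂ : pitch κ τ a r u / m = pitch κ τ a r u / ω u * (ω u / m) :=
    (div_mul_div_cancel₀ hω).symm
  simp only [meanCurvature]
  rw [hE, hF, hG, h.dt_dt_eq hu, h.du_du_eq hu, h.du_eq hu, h.dt_eq hu, helicoid, normal,
    secondForm_accel _ _ _ _ _ _ _ _ _ _ _ _ _ _ hB hr,
    secondForm_accel _ _ _ _ _ _ _ _ _ _ _ _ _ _ hB hr, mul_zero, zero_mul, sub_zero, one_mul,
    mul_div_assoc, e₁, e₂]
  generalize deriv (fun u => pitch κ τ a r u / ω u) u = f' at *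
  generalize deriv (fun u => r u / (1 + κ / 4 * r u ^ 2) / ω u) u = g' at *
  generalize pitch κ τ a r u / ω u = f at *
  generalize r u / (1 + κ / 4 * r u ^ 2) / ω u = g at *
  generalize (1 - κ / 4 * r u ^ 2) / r u = D
  generalize ω u / m = V at *
  rw [div_eq_iff (by simpa using hU)]
  linear_combination (V ^ 2 * (p u * deriv s u + s u * D)) * hfg +
    (V ^ 2 * p u * s u) * hd + (V ^ 2 * f * (2 * τ * (s u * g) - D * -(s u * f))) * hps

end IsNaturalHelicoid

end BCV

/-! ### The Bour data as polynomials in `ξ₁² / B`. -/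

namespace BCV

/-- The function `ξ₁² / B` of the Bour data, where `B` is the conformal factor at distance `ξ₁`. -/
def radial (κ τ a m : ℝ) (U : ℝ → ℝ) (u : ℝ) : ℝ :=
  xi1 κ τ a m U u ^ 2 / (1 + κ / 4 * xi1 κ τ a m U u ^ 2)

/-- With `α = 1 - 2aτ` and `y = 4q / (1 + κq)`, clearing the denominator of `q` gives `y (v + α) =
2N`, while `hv2` reads `(v - α)(v + α) = N (4τ² - κ)`. Dividing by `v + α`, which is nonzero because
the denominator and `1 + κq` are, gives `v` as an affine function of `y`, and then `N`. -/
theorem sqrt_delta_and_norm_of_quot {κ τ a N v q : ℝ}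
    (hv2 : v ^ 2 = (1 - 2 * a * τ) ^ 2 + N * (4 * τ ^ 2 - κ)) (hq : 0 < q)
    (hqD : q = N / ((1 + v) ^ 2 - 4 * τ ^ 2 * (N + a ^ 2))) (hB : 0 < 1 + κ * q) :
    v = 1 - 2 * a * τ + (4 * τ ^ 2 - κ) / 2 * (4 * q / (1 + κ * q)) ∧
      N = (1 - 2 * a * τ) * (4 * q / (1 + κ * q)) +
        (4 * τ ^ 2 - κ) / 4 * (4 * q / (1 + κ * q)) ^ 2 := by
  have hD : (1 + v) ^ 2 - 4 * τ ^ 2 * (N + a ^ 2) ≠ 0 := by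
    intro h0
    rw [h0, div_zero] at hqD
    exact hq.ne' hqD
  have hN : N = q * ((1 + v) ^ 2 - 4 * τ ^ 2 * (N + a ^ 2)) := by
    rw [eq_div_iff hD] at hqD
    exact hqD.symm
  have h1 : ((1 + v) ^ 2 - 4 * τ ^ 2 * (N + a ^ 2)) * (1 + κ * q) = 2 * (v + (1 - 2 * a * τ)) := by
    linear_combination hv2 - κ * hN
  have h2 : v + (1 - 2 * a * τ) ≠ 0 := by
    intro h0
    rw [h0, mul_zero] at h1
    exact (mul_ne_zero hD hB.ne') h1
  obtain ⟨y, hy⟩ : ∃ y, y = 4 * q / (1 + κ * q) := ⟨_, rfl⟩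
  rw [← hy]
  have hyB : y * (1 + κ * q) = 4 * q := by rw [hy, div_mul_cancel₀ _ hB.ne']
  have h3 : y * (v + (1 - 2 * a * τ)) = 2 * N := by
    apply mul_right_cancel₀ hB.ne'
    linear_combination (v + (1 - 2 * a * τ)) * hyB - 2 * q * h1 - 2 * (1 + κ * q) * hN
  have h4 : v = 1 - 2 * a * τ + (4 * τ ^ 2 - κ) / 2 * y := by
    apply mul_right_cancel₀ h2
    linear_combination hv2 - (4 * τ ^ 2 - κ) / 2 * h3
  refine ⟨h4, ?_⟩
  linear_combination -h3 / 2 + y / 2 * h4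

theorem contDiffOn_deriv {f : ℝ → ℝ} (hI : IsOpen I) (hf : ContDiffOn ℝ 2 f I) :
    ContDiffOn ℝ 1 (deriv f) I :=
  hf.deriv_of_isOpen hI (by norm_num)

namespace IsBourAdmissible

variable {κ τ a m : ℝ} {I : Set ℝ} {U : ℝ → ℝ}

theorem xi1_pos (hU : IsBourAdmissible κ τ a m I U) {u : ℝ} (hu : u ∈ I) :
    0 < xi1 κ τ a m U u :=
  mul_pos two_pos (Real.sqrt_pos.2 (hU.quot_pos u hu))

theorem xi1_sq (hU : IsBourAdmissible κ τ a m I U) {u : ℝ} (hu : u ∈ I) :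
    xi1 κ τ a m U u ^ 2 = 4 * bourQuot κ τ a m U u := by
  rw [xi1, mul_pow, Real.sq_sqrt (hU.quot_pos u hu).le]
  norm_num

theorem radial_pos (hU : IsBourAdmissible κ τ a m I U) {u : ℝ} (hu : u ∈ I) :
    0 < radial κ τ a m U u :=
  div_pos (pow_pos (hU.xi1_pos hu) 2) (hU.conf_pos u hu)

theorem sqrt_delta_and_norm (hU : IsBourAdmissible κ τ a m I U) {u : ℝ} (hu : u ∈ I) :
    √(bourDelta κ τ a m U u) =
        1 - 2 * a * τ + (4 * τ ^ 2 - κ) / 2 * radial κ τ a m U u ∧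
      m ^ 2 * U u ^ 2 - a ^ 2 = (1 - 2 * a * τ) * radial κ τ a m U u +
        (4 * τ ^ 2 - κ) / 4 * radial κ τ a m U u ^ 2 := by
  have hq := hU.quot_pos u hu
  have hB := hU.conf_pos u hu
  have e : κ / 4 * (4 * bourQuot κ τ a m U u) = κ * bourQuot κ τ a m U u := by ring
  rw [hU.xi1_sq hu, e] at hB
  rw [radial, hU.xi1_sq hu, e]
  refine sqrt_delta_and_norm_of_quot (Real.sq_sqrt (hU.delta_pos u hu).le) hq ?_ hB
  rw [bourQuot]
  ring_nf

/-- This lets `1 / B` be replaced by a polynomial in `ξ₁² / B`. -/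
theorem one_div_conf (hU : IsBourAdmissible κ τ a m I U) {u : ℝ} (hu : u ∈ I) :
    (1 - κ / 4 * radial κ τ a m U u) * (1 + κ / 4 * xi1 κ τ a m U u ^ 2) = 1 := by
  have hB := (hU.conf_pos u hu).ne'
  rw [radial]
  generalize hBd : 1 + κ / 4 * xi1 κ τ a m U u ^ 2 = B at *
  field_simp
  linear_combination -4 * hBd

/-- The squared norm of the rotational part of the Killing field. -/
theorem radial_sub_sq (hU : IsBourAdmissible κ τ a m I U) {u : ℝ} (hu : u ∈ I) :
    radial κ τ a m U u - κ / 4 * radial κ τ a m U u ^ 2 =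
      (xi1 κ τ a m U u / (1 + κ / 4 * xi1 κ τ a m U u ^ 2)) ^ 2 := by
  have hB := (hU.conf_pos u hu).ne'
  rw [radial]
  generalize hBd : 1 + κ / 4 * xi1 κ τ a m U u ^ 2 = B at *
  field_simp
  linear_combination -4 * xi1 κ τ a m U u ^ 2 * hBd

theorem radial_sub_sq_pos (hU : IsBourAdmissible κ τ a m I U) {u : ℝ} (hu : u ∈ I) :
    0 < radial κ τ a m U u - κ / 4 * radial κ τ a m U u ^ 2 := by
  rw [hU.radial_sub_sq hu]
  exact pow_pos (div_pos (hU.xi1_pos hu) (hU.conf_pos u hu)) 2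

/-- The formula for `ξ₁` is made for this: the Killing field at distance `ξ₁` from the axis has
squared length `m²U²`. -/
theorem killing_norm (hU : IsBourAdmissible κ τ a m I U) {u : ℝ} (hu : u ∈ I) :
    (m * U u) ^ 2 = (xi1 κ τ a m U u / (1 + κ / 4 * xi1 κ τ a m U u ^ 2)) ^ 2 +
      pitch κ τ a (xi1 κ τ a m U) u ^ 2 := by
  have h1 := (hU.sqrt_delta_and_norm hu).2
  rw [← hU.radial_sub_sq hu, pitch, mul_div_assoc]
  change _ = _ + (a - τ * radial κ τ a m U u) ^ 2
  linear_combination h1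

theorem contDiffOn_xi1 (hU : IsBourAdmissible κ τ a m I U) :
    ContDiffOn ℝ 2 (xi1 κ τ a m U) I := by
  have hΔ : ContDiffOn ℝ 2 (bourDelta κ τ a m U) I :=
    contDiffOn_const.add (((contDiffOn_const.mul (hU.contDiffOn.pow 2)).sub contDiffOn_const).mul
      contDiffOn_const)
  have hs : ContDiffOn ℝ 2 (fun u => √(bourDelta κ τ a m U u)) I :=
    hΔ.sqrt fun u hu => (hU.delta_pos u hu).ne'
  have hq : ContDiffOn ℝ 2 (bourQuot κ τ a m U) I := by
    refine ((contDiffOn_const.mul (hU.contDiffOn.pow 2)).sub contDiffOn_const).div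
      (((contDiffOn_const.add hs).pow 2).sub (contDiffOn_const.mul (hU.contDiffOn.pow 2))) ?_
    intro u hu h0
    have := hU.quot_pos u hu
    rw [bourQuot, h0, div_zero] at this
    exact lt_irrefl _ this
  exact contDiffOn_const.mul (hq.sqrt fun u hu => (hU.quot_pos u hu).ne')

theorem contDiffOn_conf (hU : IsBourAdmissible κ τ a m I U) :
    ContDiffOn ℝ 2 (fun u => 1 + κ / 4 * xi1 κ τ a m U u ^ 2) I :=
  contDiffOn_const.add (contDiffOn_const.mul (hU.contDiffOn_xi1.pow 2))

theorem contDiffOn_radial (hU : IsBourAdmissible κ τ a m I U) :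
    ContDiffOn ℝ 2 (radial κ τ a m U) I :=
  (hU.contDiffOn_xi1.pow 2).div hU.contDiffOn_conf fun u hu => (hU.conf_pos u hu).ne'

theorem differentiableAt_xi1 (hU : IsBourAdmissible κ τ a m I U) (hI : IsOpen I) {u : ℝ}
    (hu : u ∈ I) : DifferentiableAt ℝ (xi1 κ τ a m U) u :=
  ((hU.contDiffOn_xi1.contDiffAt (hI.mem_nhds hu)).differentiableAt (by norm_num))

theorem deriv_radial (hU : IsBourAdmissible κ τ a m I U) (hI : IsOpen I) {u : ℝ} (hu : u ∈ I) :
    deriv (radial κ τ a m U) u = 2 * xi1 κ τ a m U u * deriv (xi1 κ τ a m U) u /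
      (1 + κ / 4 * xi1 κ τ a m U u ^ 2) ^ 2 := by
  have hB := (hU.conf_pos u hu).ne'
  have hr := (hU.differentiableAt_xi1 hI hu).hasDerivAt
  have h1 := (hr.pow 2).div (((hr.pow 2).const_mul (κ / 4)).const_add 1) hB
  refine (HasDerivAt.deriv (f := radial κ τ a m U) h1).trans ?_
  simp only [Pi.pow_apply]
  congr 1
  norm_num
  ring

/-- As a polynomial in `y = ξ₁² / B`, `m²U² - a²` has derivative exactly `√Δ`, so this is the chain
rule. -/
theorem deriv_killing_norm (hU : IsBourAdmissible κ τ a m I U) (hI : IsOpen I) {u : ℝ}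
    (hu : u ∈ I) :
    2 * m ^ 2 * U u * deriv U u = √(bourDelta κ τ a m U u) * deriv (radial κ τ a m U) u := by
  have hUd : HasDerivAt U (deriv U u) u :=
    ((hU.contDiffOn.contDiffAt (hI.mem_nhds hu)).differentiableAt (by norm_num)).hasDerivAt
  have hyd : HasDerivAt (radial κ τ a m U) (deriv (radial κ τ a m U) u) u :=
    ((hU.contDiffOn_radial.contDiffAt (hI.mem_nhds hu)).differentiableAt (by norm_num)).hasDerivAt
  have hev : (fun u => m ^ 2 * U u ^ 2 - a ^ 2) =ᶠ[nhds u] fun u =>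
      (1 - 2 * a * τ) * radial κ τ a m U u +
        (4 * τ ^ 2 - κ) / 4 * radial κ τ a m U u ^ 2 := by
    filter_upwards [hI.mem_nhds hu] with x hx using (hU.sqrt_delta_and_norm hx).2
  have h1 := (((hUd.pow 2).const_mul (m ^ 2)).sub_const (a ^ 2)).congr_of_eventuallyEq hev.symm
  have h2 := h1.unique ((hyd.const_mul (1 - 2 * a * τ)).add
    ((hyd.pow 2).const_mul ((4 * τ ^ 2 - κ) / 4)))
  rw [(hU.sqrt_delta_and_norm hu).1]
  norm_num at h2
  linear_combination h2

/-- By `deriv_killing_norm`, the subtracted fraction is `B² (y'/2)²`, and `ξ₁² = B² (y - κy²/4)`. -/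
theorem radicand_eq (hU : IsBourAdmissible κ τ a m I U) (hI : IsOpen I) {u : ℝ} (hu : u ∈ I) :
    bourRadicand κ τ a m U u = (1 + κ / 4 * xi1 κ τ a m U u ^ 2) ^ 2 *
      (radial κ τ a m U u - κ / 4 * radial κ τ a m U u ^ 2 -
        (deriv (radial κ τ a m U) u / 2) ^ 2) := by
  have hB := (hU.conf_pos u hu).ne'
  have h1 := hU.deriv_killing_norm hI hu
  have hΔ := hU.delta_pos u hu
  have e : m ^ 4 * U u ^ 2 * deriv U u ^ 2 * (4 + κ * xi1 κ τ a m U u ^ 2) ^ 2 /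
      (16 * bourDelta κ τ a m U u) =
      (1 + κ / 4 * xi1 κ τ a m U u ^ 2) ^ 2 * (deriv (radial κ τ a m U) u / 2) ^ 2 := by
    rw [div_eq_iff (by positivity)]
    have h2 := Real.sq_sqrt hΔ.le
    set v := √(bourDelta κ τ a m U u)
    rw [← h2]
    linear_combination (2 * m ^ 2 * U u * deriv U u + v * deriv (radial κ τ a m U) u) / 4 *
      (4 + κ * xi1 κ τ a m U u ^ 2) ^ 2 * h1
  rw [bourRadicand, e, hU.radial_sub_sq hu, mul_sub, ← mul_pow _ (xi1 κ τ a m U u / _),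
    mul_div_cancel₀ _ hB]

end IsBourAdmissible

theorem bourSurface_eq (κ τ a m : ℝ) (U ξ ϑ : ℝ → ℝ) :
    bourSurface κ τ a m U ξ ϑ = helicoid a m (xi1 κ τ a m U) ξ ϑ := by
  funext u t
  simp [bourSurface, helicoid, cyl]

end BCV

/-! ### Bour surfaces as natural helicoids, and their curvature equation. -/

namespace BCV

variable {κ τ a m : ℝ} {I : Set ℝ} {U ρ ξ ϑ : ℝ → ℝ}

theorem IsBourAdmissible.deriv_radial_div_two (hU : IsBourAdmissible κ τ a m I U) (hI : IsOpen I)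
    {u : ℝ} (hu : u ∈ I) : deriv (radial κ τ a m U) u / 2 =
      xi1 κ τ a m U u / (1 + κ / 4 * xi1 κ τ a m U u ^ 2) *
        (deriv (xi1 κ τ a m U) u / (1 + κ / 4 * xi1 κ τ a m U u ^ 2)) := by
  rw [hU.deriv_radial hI hu]
  generalize 1 + κ / 4 * xi1 κ τ a m U u ^ 2 = B
  ring

theorem contDiffOn_of_hasDerivAt {f g : ℝ → ℝ} (hI : IsOpen I)
    (hf : ∀ u ∈ I, HasDerivAt f (g u) u) (hg : ContDiffOn ℝ 1 g I) : ContDiffOn ℝ 2 f I := by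
  have h2 : (2 : WithTop ℕ∞) = 1 + 1 := by norm_num
  rw [h2, contDiffOn_succ_iff_deriv_of_isOpen hI]
  refine ⟨fun u hu => (hf u hu).differentiableAt.differentiableWithinAt, by simp, ?_⟩
  exact hg.congr fun u hu => (hf u hu).deriv

theorem IsBourAdmissible.contDiffOn_xi2_deriv (hU : IsBourAdmissible κ τ a m I U)
    (hρ : ContDiffOn ℝ 1 ρ I) : ContDiffOn ℝ 1 (fun u => m * U u *
      (4 + κ * xi1 κ τ a m U u ^ 2) / (4 * xi1 κ τ a m U u ^ 2) * ρ u) I := by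
  have hr : ContDiffOn ℝ 1 (xi1 κ τ a m U) I := hU.contDiffOn_xi1.of_le (by norm_num)
  have hUc : ContDiffOn ℝ 1 U I := hU.contDiffOn.of_le (by norm_num)
  refine (((contDiffOn_const.mul hUc).mul
    (contDiffOn_const.add (contDiffOn_const.mul (hr.pow 2)))).div
    (contDiffOn_const.mul (hr.pow 2)) fun u hu => ?_).mul hρ
  have := hU.xi1_pos hu
  positivity

theorem IsBourAdmissible.contDiffOn_theta_deriv (hU : IsBourAdmissible κ τ a m I U) (hm : m ≠ 0)
    (hρ : ContDiffOn ℝ 1 ρ I) : ContDiffOn ℝ 1 (fun u =>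
      ((4 * τ - a * κ) * xi1 κ τ a m U u ^ 2 - 4 * a) /
        (4 * m * U u * xi1 κ τ a m U u ^ 2) * ρ u) I := by
  have hr : ContDiffOn ℝ 1 (xi1 κ τ a m U) I := hU.contDiffOn_xi1.of_le (by norm_num)
  have hUc : ContDiffOn ℝ 1 U I := hU.contDiffOn.of_le (by norm_num)
  refine (((contDiffOn_const.mul (hr.pow 2)).sub contDiffOn_const).div
    ((contDiffOn_const.mul hUc).mul (hr.pow 2)) fun u hu => ?_).mul hρ
  have := hU.xi1_pos hu
  have := hU.pos u hu
  positivity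

namespace IsBourProfile

theorem contDiffOn_surface (h : IsBourProfile κ τ a m I U ρ ξ ϑ)
    (hU : IsBourAdmissible κ τ a m I U) (hI : IsOpen I) (hm : m ≠ 0) :
    ContDiffOn ℝ 2 (fun q : ℝ × ℝ => bourSurface κ τ a m U ξ ϑ q.1 q.2) (I ×ˢ Set.univ) := by
  have hfst : ContDiffOn ℝ 2 (Prod.fst : ℝ × ℝ → ℝ) (I ×ˢ Set.univ) := contDiff_fst.contDiffOn
  have hmaps : Set.MapsTo (Prod.fst : ℝ × ℝ → ℝ) (I ×ˢ Set.univ) I := fun q hq => hq.1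
  have hr : ContDiffOn ℝ 2 (fun q : ℝ × ℝ => xi1 κ τ a m U q.1) (I ×ˢ Set.univ) :=
    hU.contDiffOn_xi1.comp hfst hmaps
  have hξ : ContDiffOn ℝ 2 (fun q : ℝ × ℝ => ξ q.1) (I ×ˢ Set.univ) :=
    (contDiffOn_of_hasDerivAt hI h.deriv_xi2
      (hU.contDiffOn_xi2_deriv h.contDiffOn)).comp hfst hmaps
  have hϑ : ContDiffOn ℝ 2 (fun q : ℝ × ℝ => ϑ q.1) (I ×ˢ Set.univ) :=
    (contDiffOn_of_hasDerivAt hI h.deriv_theta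
      (hU.contDiffOn_theta_deriv hm h.contDiffOn)).comp hfst hmaps
  have hφ : ContDiffOn ℝ 2 (fun q : ℝ × ℝ => q.2 / m + ϑ q.1) (I ×ˢ Set.univ) :=
    (contDiff_snd.contDiffOn.div_const m).add hϑ
  rw [contDiffOn_pi]
  intro i
  fin_cases i
  · exact hr.mul hφ.cos
  · exact hr.mul hφ.sin
  · exact hξ.add (contDiffOn_const.mul hφ)

theorem sq_orbit (h : IsBourProfile κ τ a m I U ρ ξ ϑ)
    (hU : IsBourAdmissible κ τ a m I U) (hI : IsOpen I) {u : ℝ} (hu : u ∈ I) :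
    ((1 - κ / 4 * radial κ τ a m U u) * ρ u) ^ 2 + (deriv (radial κ τ a m U) u / 2) ^ 2 =
      radial κ τ a m U u - κ / 4 * radial κ τ a m U u ^ 2 := by
  have h1 := hU.one_div_conf hu
  rw [mul_pow, h.sq_eq u hu, hU.radicand_eq hI hu, ← mul_assoc, ← mul_pow, h1]
  ring

/-- The choice of `ρ` encodes unit speed: with cosine `ξ₁' / B`, the radicand is `ξ₁²` times the
squared sine. -/
theorem isNaturalHelicoid (h : IsBourProfile κ τ a m I U ρ ξ ϑ)
    (hU : IsBourAdmissible κ τ a m I U) (hI : IsOpen I) (hm : m ≠ 0) :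
    IsNaturalHelicoid κ τ a m I (xi1 κ τ a m U)
      (fun u => deriv (xi1 κ τ a m U) u / (1 + κ / 4 * xi1 κ τ a m U u ^ 2))
      (fun u => ρ u / xi1 κ τ a m U u) (fun u => m * U u) ξ ϑ where
  isOpen := hI
  r_pos u hu := hU.xi1_pos hu
  conf_pos := hU.conf_pos
  deriv_r u hu := by
    rw [mul_div_cancel₀ _ (hU.conf_pos u hu).ne']
    exact (hU.differentiableAt_xi1 hI hu).hasDerivAt
  sq_add_sq u hu := by
    have hB := (hU.conf_pos u hu).ne'
    have hr := (hU.xi1_pos hu).ne'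
    have h1 := h.sq_eq u hu
    rw [hU.radicand_eq hI hu, hU.radial_sub_sq hu, hU.deriv_radial_div_two hI hu] at h1
    generalize 1 + κ / 4 * xi1 κ τ a m U u ^ 2 = B at *
    field_simp
    field_simp at h1
    linear_combination h1
  diff_p u hu := by
    have h1 : DifferentiableAt ℝ (deriv (xi1 κ τ a m U)) u :=
      ((contDiffOn_deriv hI hU.contDiffOn_xi1).contDiffAt
        (hI.mem_nhds hu)).differentiableAt (by norm_num)
    have h2 : DifferentiableAt ℝ (fun u => 1 + κ / 4 * xi1 κ τ a m U u ^ 2) u :=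
      (hU.contDiffOn_conf.contDiffAt (hI.mem_nhds hu)).differentiableAt (by norm_num)
    exact h1.div h2 (hU.conf_pos u hu).ne'
  diff_s u hu := ((h.contDiffOn.contDiffAt (hI.mem_nhds hu)).differentiableAt (by norm_num)).div
    (hU.differentiableAt_xi1 hI hu) (hU.xi1_pos hu).ne'
  diff_ω u hu := ((hU.contDiffOn.contDiffAt (hI.mem_nhds hu)).differentiableAt
    (by norm_num)).const_mul m
  ω_pos u hu := by
    rw [mul_div_cancel_left₀ _ hm]
    exact hU.pos u hu
  ω_sq u hu := hU.killing_norm hu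
  deriv_ξ u hu := by
    have hr := (hU.xi1_pos hu).ne'
    refine (h.deriv_xi2 u hu).congr_deriv ?_
    field_simp
  deriv_ϑ u hu := by
    have hr := (hU.xi1_pos hu).ne'
    have hB := (hU.conf_pos u hu).ne'
    have hUu := (hU.pos u hu).ne'
    refine (h.deriv_theta u hu).congr_deriv ?_
    rw [pitch]
    obtain ⟨B, hBd⟩ : ∃ B, B = 1 + κ / 4 * xi1 κ τ a m U u ^ 2 := ⟨_, rfl⟩
    rw [← hBd] at hB ⊢
    field_simp
    rw [hBd]
    ring

/-- The mean curvature of a Bour surface in terms of the function `ξ₁² / B`. -/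
theorem hasMeanCurvature_iff (h : IsBourProfile κ τ a m I U ρ ξ ϑ)
    (hU : IsBourAdmissible κ τ a m I U) (hI : IsOpen I) (hm : m ≠ 0) (H : ℝ) :
    HasMeanCurvature κ τ (bourSurface κ τ a m U ξ ϑ) I H ↔ ∀ u ∈ I,
      deriv (radial κ τ a m U) u / 2 *
          deriv (fun u => (1 - κ / 4 * radial κ τ a m U u) * ρ u) u -
        (1 - κ / 4 * radial κ τ a m U u) * ρ u * (deriv (deriv (radial κ τ a m U)) u / 2) +
        (1 - κ / 4 * radial κ τ a m U u) * ρ u * (1 - κ / 2 * radial κ τ a m U u) =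
      H * (radial κ τ a m U u - κ / 4 * radial κ τ a m U u ^ 2) := by
  have hN := h.isNaturalHelicoid hU hI hm
  have key : ∀ u ∈ I, ∀ t : ℝ,
      ((∃ n : Fin 3 → ℝ, IsPosUnitNormal κ τ (bourSurface κ τ a m U ξ ϑ) u t n ∧
        meanCurvature κ τ (bourSurface κ τ a m U ξ ϑ) n u t = H) ↔
      deriv (radial κ τ a m U) u / 2 *
          deriv (fun u => (1 - κ / 4 * radial κ τ a m U u) * ρ u) u -
        (1 - κ / 4 * radial κ τ a m U u) * ρ u * (deriv (deriv (radial κ τ a m U)) u / 2) +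
        (1 - κ / 4 * radial κ τ a m U u) * ρ u * (1 - κ / 2 * radial κ τ a m U u) =
      H * (radial κ τ a m U u - κ / 4 * radial κ τ a m U u ^ 2)) := by
    intro u hu t
    rw [bourSurface_eq]
    simp only [hN.isPosUnitNormal_iff hu t, exists_eq_left]
    rw [hN.meanCurvature_eq hu t]
    have hr := (hU.xi1_pos hu).ne'
    have hB := (hU.conf_pos u hu).ne'
    -- the factor `ξ₁ / B` relates the two forms of the equation
    have hg : DifferentiableAt ℝ
        (fun u => xi1 κ τ a m U u / (1 + κ / 4 * xi1 κ τ a m U u ^ 2)) u :=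
      (hU.differentiableAt_xi1 hI hu).div ((hU.contDiffOn_conf.contDiffAt
        (hI.mem_nhds hu)).differentiableAt (by norm_num)) hB
    have hW : (fun u => (1 - κ / 4 * radial κ τ a m U u) * ρ u) =ᶠ[nhds u] fun u =>
        xi1 κ τ a m U u / (1 + κ / 4 * xi1 κ τ a m U u ^ 2) * (ρ u / xi1 κ τ a m U u) := by
      filter_upwards [hI.mem_nhds hu] with x hx
      have h1 := hU.one_div_conf hx
      have hrx := (hU.xi1_pos hx).ne'
      have hBx := (hU.conf_pos x hx).ne'
      rw [← eq_div_iff hBx] at h1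
      rw [h1]
      field_simp
    have hP : deriv (radial κ τ a m U) =ᶠ[nhds u] fun u =>
        2 * (xi1 κ τ a m U u / (1 + κ / 4 * xi1 κ τ a m U u ^ 2) *
          (deriv (xi1 κ τ a m U) u / (1 + κ / 4 * xi1 κ τ a m U u ^ 2))) := by
      filter_upwards [hI.mem_nhds hu] with x hx
      rw [← hU.deriv_radial_div_two hI hx]
      ring
    have hW0 := hW.eq_of_nhds
    have hP0 := hP.eq_of_nhds
    have hW1 := ((hg.hasDerivAt.mul (hN.diff_s u hu).hasDerivAt).congr_of_eventuallyEq hW).deriv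
    have hP1 := (((hg.hasDerivAt.mul (hN.diff_p u hu).hasDerivAt).const_mul
      2).congr_of_eventuallyEq hP).deriv
    rw [hW1, hP1, hW0, hP0, hU.radial_sub_sq hu]
    have e : 1 - κ / 2 * radial κ τ a m U u =
        xi1 κ τ a m U u / (1 + κ / 4 * xi1 κ τ a m U u ^ 2) *
          ((1 - κ / 4 * xi1 κ τ a m U u ^ 2) / xi1 κ τ a m U u) := by
      rw [radial]
      obtain ⟨B, hBd⟩ : ∃ B, B = 1 + κ / 4 * xi1 κ τ a m U u ^ 2 := ⟨_, rfl⟩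
      rw [← hBd] at hB ⊢
      field_simp
      rw [hBd]
      ring
    rw [e]
    have hg0 : xi1 κ τ a m U u / (1 + κ / 4 * xi1 κ τ a m U u ^ 2) ≠ 0 := div_ne_zero hr hB
    generalize xi1 κ τ a m U u / (1 + κ / 4 * xi1 κ τ a m U u ^ 2) = g at *
    -- With `W = g s` and `y'/2 = g p`, the terms in `g'` cancel in `(y'/2) W' - W (y''/2)`, which
    -- leaves `g²` times the curvature formula.
    rw [← mul_left_inj' (pow_ne_zero 2 hg0)]
    refine eq_iff_eq_of_sub_eq_sub ?_
    ring
  constructor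
  · intro hH u hu
    exact (key u hu 0).1 (hH.mean_eq u hu 0)
  · intro hH
    refine ⟨h.contDiffOn_surface hU hI hm, ?_, fun u hu t => (key u hu t).2 (hH u hu)⟩
    intro u hu t
    rw [bourSurface_eq, helicoid, space, Set.mem_ofPred_eq, conf_cyl]
    exact hU.conf_pos u hu

end IsBourProfile

/-- Every admissible `U` with a branch of the square root has a Bour surface. -/
theorem IsBourAdmissible.exists_isBourProfile (hU : IsBourAdmissible κ τ a m I U) (hI : IsOpen I)
    (hI' : I.OrdConnected) (hne : I.Nonempty) (hm : m ≠ 0) {ρ : ℝ → ℝ} (hρ : ContDiffOn ℝ 1 ρ I)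
    (hρ2 : ∀ u ∈ I, ρ u ^ 2 = bourRadicand κ τ a m U u) :
    ∃ ξ ϑ : ℝ → ℝ, IsBourProfile κ τ a m I U ρ ξ ϑ := by
  obtain ⟨u₁, hu₁⟩ := hne
  have key : ∀ f : ℝ → ℝ, ContinuousOn f I → ∃ F : ℝ → ℝ, ∀ u ∈ I, HasDerivAt F (f u) u := by
    intro f hf
    refine ⟨fun u => ∫ x in u₁..u, f x, fun u hu => ?_⟩
    refine intervalIntegral.integral_hasDerivAt_right ?_ ?_ (hf.continuousAt (hI.mem_nhds hu))
    · exact (hf.mono (hI'.uIcc_subset hu₁ hu)).intervalIntegrable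
    · exact hf.stronglyMeasurableAtFilter hI u hu
  obtain ⟨ξ, hξ⟩ := key _ (hU.contDiffOn_xi2_deriv hρ).continuousOn
  obtain ⟨ϑ, hϑ⟩ := key _ (hU.contDiffOn_theta_deriv hm hρ).continuousOn
  exact ⟨ξ, ϑ, hρ, hρ2, hξ, hϑ⟩

end BCV

/-! ### The flux integral and the choice of the branch. -/

namespace BCV

/-- The differential equations for `y = ξ₁² / B` on a surface of constant mean curvature `H`; here `k` is
the value of the first integral. -/
structure IsFlux (κ H k : ℝ) (I : Set ℝ) (y : ℝ → ℝ) : Prop where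
  hasDerivAt : ∀ u ∈ I, HasDerivAt y (deriv y u) u
  hasDerivAt_deriv : ∀ u ∈ I, HasDerivAt (deriv y) (2 - 2 * H * k - (H ^ 2 + κ) * y u) u
  energy : ∀ u ∈ I, (deriv y u / 2) ^ 2 = y u - κ / 4 * y u ^ 2 - (k + H / 2 * y u) ^ 2

/-- Reversing the normal changes the signs of both `H` and `k`; only `H²`, `Hk` and `(k + H y/2)²`
occur. -/
theorem IsFlux.neg {κ H k : ℝ} {I : Set ℝ} {y : ℝ → ℝ} (h : IsFlux κ (-H) k I y) :
    IsFlux κ H (-k) I y where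
  hasDerivAt := h.hasDerivAt
  hasDerivAt_deriv u hu := (h.hasDerivAt_deriv u hu).congr_deriv (by ring)
  energy u hu := (h.energy u hu).trans (by ring)

variable {κ τ a m H k : ℝ} {I : Set ℝ} {U ρ ξ ϑ : ℝ → ℝ}

namespace IsBourAdmissible

theorem hasDerivAt_radial (hU : IsBourAdmissible κ τ a m I U) (hI : IsOpen I) {u : ℝ} (hu : u ∈ I) :
    HasDerivAt (radial κ τ a m U) (deriv (radial κ τ a m U) u) u :=
  ((hU.contDiffOn_radial.contDiffAt (hI.mem_nhds hu)).differentiableAt (by norm_num)).hasDerivAt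

theorem hasDerivAt_deriv_radial (hU : IsBourAdmissible κ τ a m I U) (hI : IsOpen I) {u : ℝ}
    (hu : u ∈ I) :
    HasDerivAt (deriv (radial κ τ a m U)) (deriv (deriv (radial κ τ a m U)) u) u :=
  (((contDiffOn_deriv hI hU.contDiffOn_radial).contDiffAt (hI.mem_nhds hu)).differentiableAt
    (by norm_num)).hasDerivAt

theorem contDiffOn_orbit (hU : IsBourAdmissible κ τ a m I U) (hρ : ContDiffOn ℝ 1 ρ I) :
    ContDiffOn ℝ 1 (fun u => (1 - κ / 4 * radial κ τ a m U u) * ρ u) I :=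
  (contDiffOn_const.sub (contDiffOn_const.mul (hU.contDiffOn_radial.of_le (by norm_num)))).mul hρ

end IsBourAdmissible

namespace IsBourProfile

theorem hasDerivAt_orbit (h : IsBourProfile κ τ a m I U ρ ξ ϑ)
    (hU : IsBourAdmissible κ τ a m I U) (hI : IsOpen I) {u : ℝ} (hu : u ∈ I) :
    HasDerivAt (fun u => (1 - κ / 4 * radial κ τ a m U u) * ρ u)
      (deriv (fun u => (1 - κ / 4 * radial κ τ a m U u) * ρ u) u) u :=
  (((hU.contDiffOn_orbit h.contDiffOn).contDiffAt (hI.mem_nhds hu)).differentiableAt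
    (by norm_num)).hasDerivAt

/-- A surface of constant mean curvature satisfies the flux equations. -/
theorem exists_isFlux (h : IsBourProfile κ τ a m I U ρ ξ ϑ)
    (hU : IsBourAdmissible κ τ a m I U) (hI : IsOpen I) (hI' : I.OrdConnected) (hm : m ≠ 0)
    (hH : HasMeanCurvature κ τ (bourSurface κ τ a m U ξ ϑ) I H) :
    ∃ k, IsFlux κ H k I (radial κ τ a m U) := by
  rw [h.hasMeanCurvature_iff hU hI hm] at hH
  have hy := fun u hu => hU.hasDerivAt_radial hI (u := u) hu
  have hy1 := fun u hu => hU.hasDerivAt_deriv_radial hI (u := u) hu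
  have hW := fun u hu => h.hasDerivAt_orbit hU hI (u := u) hu
  have hsq := fun u hu => h.sq_orbit hU hI (u := u) hu
  have hQ := fun u hu => hU.radial_sub_sq_pos (u := u) hu
  obtain ⟨W, hWd⟩ : ∃ W, W = fun u => (1 - κ / 4 * radial κ τ a m U u) * ρ u := ⟨_, rfl⟩
  have hWu : ∀ u, (1 - κ / 4 * radial κ τ a m U u) * ρ u = W u := fun u => by rw [hWd]
  rw [← hWd] at hW
  simp only [hWu] at hH hsq
  rw [show (fun u => W u) = W from rfl] at hH
  generalize radial κ τ a m U = y at *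
  -- The derivative of the constraint `W² + (y'/2)² = y - κy²/4`.
  have hsq' : ∀ u ∈ I, W u * deriv W u + deriv y u / 2 * (deriv (deriv y) u / 2) =
      deriv y u / 2 * (1 - κ / 2 * y u) := by
    intro u hu
    have hev : (fun u => W u ^ 2 + (deriv y u / 2) ^ 2) =ᶠ[nhds u]
        fun u => y u - κ / 4 * y u ^ 2 := by
      filter_upwards [hI.mem_nhds hu] with x hx using hsq x hx
    have h1 := (((hW u hu).pow 2).add (((hy1 u hu).div_const 2).pow 2)).congr_of_eventuallyEq
      hev.symm
    have h2 := h1.unique ((hy u hu).sub (((hy u hu).pow 2).const_mul (κ / 4)))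
    norm_num at h2
    linear_combination h2 / 2
  -- Cramer's rule for the curvature equation and the differentiated constraint, as linear equations
  -- in `W'` and `y''/2`; the determinant is `W² + (y'/2)² > 0`.
  have hW' : ∀ u ∈ I, deriv W u = H * (deriv y u / 2) := by
    intro u hu
    apply mul_left_cancel₀ (hQ u hu).ne'
    linear_combination deriv y u / 2 * hH u hu + W u * hsq' u hu - deriv W u * hsq u hu
  have hP' : ∀ u ∈ I, deriv (deriv y) u / 2 = 1 - κ / 2 * y u - H * W u := by
    intro u hu
    apply mul_left_cancel₀ (hQ u hu).ne'
    linear_combination deriv y u / 2 * hsq' u hu - W u * hH u hu -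
      (deriv (deriv y) u / 2 - (1 - κ / 2 * y u)) * hsq u hu
  have hd : ∀ u ∈ I, HasDerivAt (fun u => W u - H / 2 * y u) 0 u := by
    intro u hu
    refine ((hW u hu).sub ((hy u hu).const_mul (H / 2))).congr_deriv ?_
    rw [hW' u hu]
    ring
  obtain ⟨k, hk⟩ := hI.exists_is_const_of_deriv_eq_zero hI'.isPreconnected
    (fun u hu => (hd u hu).differentiableAt.differentiableWithinAt) (fun u hu => (hd u hu).deriv)
  have hWk : ∀ u ∈ I, W u = k + H / 2 * y u := fun u hu => by linear_combination hk u hu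
  refine ⟨k, hy, fun u hu => (hy1 u hu).congr_deriv ?_, fun u hu => ?_⟩
  · linear_combination 2 * hP' u hu - 2 * H * hWk u hu
  · rw [← hWk u hu]
    linear_combination hsq u hu

end IsBourProfile

/-- The flux equations give a surface of constant mean curvature for a suitable branch. -/
theorem IsFlux.exists_isBourProfile (h : IsFlux κ H k I (radial κ τ a m U))
    (hU : IsBourAdmissible κ τ a m I U) (hI : IsOpen I) (hI' : I.OrdConnected)
    (hne : I.Nonempty) (hm : m ≠ 0) :
    ∃ ρ ξ ϑ : ℝ → ℝ, IsBourProfile κ τ a m I U ρ ξ ϑ ∧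
      HasMeanCurvature κ τ (bourSurface κ τ a m U ξ ϑ) I H := by
  -- This branch makes `W = ρ / B` equal to `k + H y/2`, with the sign required for `H`; the energy
  -- identity says that its square is the radicand.
  have hρ : ContDiffOn ℝ 1 (fun u => (1 + κ / 4 * xi1 κ τ a m U u ^ 2) *
      (k + H / 2 * radial κ τ a m U u)) I :=
    (hU.contDiffOn_conf.mul (contDiffOn_const.add
      (contDiffOn_const.mul hU.contDiffOn_radial))).of_le (by norm_num)
  obtain ⟨ξ, ϑ, hprof⟩ := hU.exists_isBourProfile hI hI' hne hm hρ (by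
    intro u hu
    rw [hU.radicand_eq hI hu, h.energy u hu]
    ring)
  refine ⟨_, ξ, ϑ, hprof, ?_⟩
  rw [hprof.hasMeanCurvature_iff hU hI hm]
  intro u hu
  have hWu : ∀ x ∈ I, (1 - κ / 4 * radial κ τ a m U x) *
      ((1 + κ / 4 * xi1 κ τ a m U x ^ 2) * (k + H / 2 * radial κ τ a m U x)) =
      k + H / 2 * radial κ τ a m U x := by
    intro x hx
    rw [← mul_assoc, hU.one_div_conf hx, one_mul]
  have hev : (fun x => (1 - κ / 4 * radial κ τ a m U x) *
      ((1 + κ / 4 * xi1 κ τ a m U x ^ 2) * (k + H / 2 * radial κ τ a m U x))) =ᶠ[nhds u]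
      fun x => k + H / 2 * radial κ τ a m U x := by
    filter_upwards [hI.mem_nhds hu] with x hx using hWu x hx
  rw [((((h.hasDerivAt u hu).const_mul (H / 2)).const_add k).congr_of_eventuallyEq hev).deriv,
    hWu u hu, (h.hasDerivAt_deriv u hu).deriv]
  linear_combination H * h.energy u hu

/-- At a common zero of two functions with equal squares, the derivatives have equal squares. -/
theorem deriv_sq_eq_of_sq_eq {f g : ℝ → ℝ} {f' g' x : ℝ} (hf : HasDerivAt f f' x)
    (hg : HasDerivAt g g' x) (h0 : f x = 0) (hev : (fun u => f u ^ 2) =ᶠ[nhds x] fun u => g u ^ 2) :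
    f' ^ 2 = g' ^ 2 := by
  have g0 : g x = 0 := by
    have := hev.eq_of_nhds
    simp only [h0] at this
    exact pow_eq_zero_iff (two_ne_zero) |>.1 (by rw [← this]; norm_num)
  -- Since both functions vanish at `x`, the squares of their difference quotients agree near `x`.
  have h1 := (hasDerivAt_iff_tendsto_slope.1 hf).pow 2
  have h2 := (hasDerivAt_iff_tendsto_slope.1 hg).pow 2
  refine tendsto_nhds_unique h1 (h2.congr' ?_)
  filter_upwards [hev.filter_mono nhdsWithin_le_nhds] with u hu
  simp only [slope_def_field, h0, g0, sub_zero, div_pow]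
  rw [hu]

/-- The flux equations imply that every branch has constant mean curvature up to the sign. -/
theorem IsFlux.hasMeanCurvature_or (h : IsFlux κ H k I (radial κ τ a m U))
    (hprof : IsBourProfile κ τ a m I U ρ ξ ϑ)
    (hU : IsBourAdmissible κ τ a m I U) (hI : IsOpen I) (hI' : I.OrdConnected) (hm : m ≠ 0) :
    HasMeanCurvature κ τ (bourSurface κ τ a m U ξ ϑ) I H ∨
      HasMeanCurvature κ τ (bourSurface κ τ a m U ξ ϑ) I (-H) := by
  rw [hprof.hasMeanCurvature_iff hU hI hm, hprof.hasMeanCurvature_iff hU hI hm]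
  have hWc := hU.contDiffOn_orbit hprof.contDiffOn
  have hyc := hU.contDiffOn_radial
  have hy1 := fun u hu => hU.hasDerivAt_deriv_radial hI (u := u) hu
  have hW := fun u hu => hprof.hasDerivAt_orbit hU hI (u := u) hu
  have hsq := fun u hu => hprof.sq_orbit hU hI (u := u) hu
  have hQ := fun u hu => hU.radial_sub_sq_pos (u := u) hu
  obtain ⟨W, hWd⟩ : ∃ W, W = fun u => (1 - κ / 4 * radial κ τ a m U u) * ρ u := ⟨_, rfl⟩
  have hWu : ∀ u, (1 - κ / 4 * radial κ τ a m U u) * ρ u = W u := fun u => by rw [hWd]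
  rw [← hWd] at hW hWc
  simp only [hWu] at hsq ⊢
  rw [show (fun u => W u) = W from rfl]
  generalize radial κ τ a m U = y at *
  have hW2 : ∀ u ∈ I, W u ^ 2 = (k + H / 2 * y u) ^ 2 := fun u hu => by
    linear_combination hsq u hu - h.energy u hu
  have hev : ∀ u ∈ I, (fun u => W u ^ 2) =ᶠ[nhds u] fun u => (k + H / 2 * y u) ^ 2 := by
    intro u hu
    filter_upwards [hI.mem_nhds hu] with x hx using hW2 x hx
  have hw : ∀ u ∈ I, HasDerivAt (fun u => k + H / 2 * y u) (H / 2 * deriv y u) u :=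
    fun u hu => ((h.hasDerivAt u hu).const_mul (H / 2)).const_add k
  -- `z` is the mean curvature multiplied by the positive function `y - κy²/4`.
  set z : ℝ → ℝ := fun u => deriv y u / 2 * deriv W u - W u * (deriv (deriv y) u / 2) +
    W u * (1 - κ / 2 * y u) with hz
  have hz2 : ∀ u ∈ I, z u ^ 2 = (H * (y u - κ / 4 * y u ^ 2)) ^ 2 := by
    intro u hu
    have hdd := (h.hasDerivAt_deriv u hu).deriv
    have e1 : z u = deriv y u / 2 * deriv W u + W u * (H * (k + H / 2 * y u)) := by
      rw [hz]
      simp only [hdd]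
      ring
    rw [e1]
    -- Where `W ≠ 0`, `W'` follows by differentiating `W² = (k + H y/2)²`. At a zero of `W`, where
    -- the branch may cross from one sign to the other, only `W'² = (H y'/2)²` is available, and it
    -- suffices.
    by_cases h0 : W u = 0
    · have h1 := deriv_sq_eq_of_sq_eq (hW u hu) (hw u hu) h0 (hev u hu)
      have h2 := hsq u hu
      rw [h0] at h2 ⊢
      rw [← h2]
      linear_combination (deriv y u / 2) ^ 2 * h1
    · have h1 := (((hW u hu).pow 2).congr_of_eventuallyEq (hev u hu).symm).unique
        ((hw u hu).pow 2)
      norm_num at h1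
      apply mul_left_cancel₀ (pow_ne_zero 2 h0)
      have h3 : W u * (deriv y u / 2 * deriv W u + W u * (H * (k + H / 2 * y u))) =
          H * (k + H / 2 * y u) * (y u - κ / 4 * y u ^ 2) := by
        linear_combination deriv y u / 4 * h1 +
          H * (k + H / 2 * y u) * (hsq u hu)
      rw [← mul_pow, h3]
      linear_combination -(H * (y u - κ / 4 * y u ^ 2)) ^ 2 * hW2 u hu
  have hzc : ContinuousOn z I := by
    have c1 : ContinuousOn (deriv y) I := (contDiffOn_deriv hI hyc).continuousOn
    have c2 : ContinuousOn (deriv (deriv y)) I :=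
      (contDiffOn_deriv hI hyc).continuousOn_deriv_of_isOpen hI (by norm_num)
    have c3 : ContinuousOn (deriv W) I := hWc.continuousOn_deriv_of_isOpen hI (by norm_num)
    have c4 := hyc.continuousOn
    have c5 := hWc.continuousOn
    rw [hz]
    fun_prop
  by_cases hH : H = 0
  · left
    intro u hu
    have := hz2 u hu
    rw [hH, zero_mul, zero_pow two_ne_zero] at this
    rw [hH, zero_mul]
    exact pow_eq_zero_iff two_ne_zero |>.1 this
  · have hQc : ContinuousOn (fun u => H * (y u - κ / 4 * y u ^ 2)) I :=
      continuousOn_const.mul (hyc.continuousOn.sub (continuousOn_const.mul (hyc.continuousOn.pow 2)))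
    -- For `H ≠ 0` the comparison function has no zero, so the sign cannot change on the connected
    -- set `I`.
    rcases hI'.isPreconnected.eq_or_eq_neg_of_sq_eq hzc hQc hz2
      (fun {u} hu => mul_ne_zero hH (hQ u hu).ne') with h1 | h1
    · exact Or.inl fun u hu => h1 hu
    · refine Or.inr fun u hu => (h1 hu).trans ?_
      simp

end BCV

/-! ### Integrating the linear equations. -/

namespace BCV

variable {κ τ a m H k c u₀ w R : ℝ} {I : Set ℝ} {U g g₁ : ℝ → ℝ}

theorem exists_eq_const {f : ℝ → ℝ} (hI : IsOpen I) (hI' : I.OrdConnected)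
    (hf : ∀ u ∈ I, HasDerivAt f 0 u) : ∃ A, ∀ u ∈ I, f u = A :=
  hI.exists_is_const_of_deriv_eq_zero hI'.isPreconnected
    (fun u hu => (hf u hu).differentiableAt.differentiableWithinAt) fun u hu => (hf u hu).deriv

theorem exists_polar {X Y : ℝ} (hR : 0 ≤ R) (h : X ^ 2 + Y ^ 2 = R ^ 2) :
    ∃ θ : ℝ, X = R * Real.cos θ ∧ Y = R * Real.sin θ := by
  have hn : ‖(⟨X, Y⟩ : ℂ)‖ = R := by
    rw [Complex.norm_def, Complex.normSq_mk, ← Real.sqrt_sq hR, ← h]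
    congr 1
    ring
  refine ⟨Complex.arg ⟨X, Y⟩, ?_, ?_⟩
  · rw [← hn, Complex.norm_mul_cos_arg]
  · rw [← hn, Complex.norm_mul_sin_arg]

/-- Rotating the vector `(w g, g₁)` through the angle `w u` makes it constant. By the energy its
length is `w R`, and its polar angle is the phase; `R = 0` needs no separate treatment. -/
theorem eq_mul_sin_of_hasDerivAt (hI : IsOpen I) (hI' : I.OrdConnected) (hw : 0 < w) (hR : 0 ≤ R)
    (hne : I.Nonempty)
    (hg : ∀ u ∈ I, HasDerivAt g (g₁ u) u) (hg₁ : ∀ u ∈ I, HasDerivAt g₁ (-(w ^ 2 * g u)) u)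
    (hE : ∀ u ∈ I, g₁ u ^ 2 + w ^ 2 * g u ^ 2 = w ^ 2 * R ^ 2) :
    ∃ u₀, ∀ u ∈ I, g u = R * Real.sin (w * (u - u₀)) := by
  have hl : ∀ u, HasDerivAt (fun u => w * u) w u := fun u => by
    simpa using (hasDerivAt_id u).const_mul w
  obtain ⟨X, hX⟩ := exists_eq_const (f := fun u => w * g u * Real.cos (w * u) -
    g₁ u * Real.sin (w * u)) hI hI' (by
    intro u hu
    refine ((((hg u hu).const_mul w).mul (hl u).cos).sub
      ((hg₁ u hu).mul (hl u).sin)).congr_deriv ?_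
    ring)
  obtain ⟨Y, hY⟩ := exists_eq_const (f := fun u => w * g u * Real.sin (w * u) +
    g₁ u * Real.cos (w * u)) hI hI' (by
    intro u hu
    refine ((((hg u hu).const_mul w).mul (hl u).sin).add
      ((hg₁ u hu).mul (hl u).cos)).congr_deriv ?_
    ring)
  have hXY : Y ^ 2 + (-X) ^ 2 = (w * R) ^ 2 := by
    obtain ⟨u₁, hu₁⟩ := hne
    rw [← hX u₁ hu₁, ← hY u₁ hu₁]
    linear_combination hE u₁ hu₁ + (w ^ 2 * g u₁ ^ 2 + g₁ u₁ ^ 2) *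
      Real.sin_sq_add_cos_sq (w * u₁)
  obtain ⟨θ, h1, h2⟩ := exists_polar (mul_nonneg hw.le hR) hXY
  refine ⟨θ / w, fun u hu => ?_⟩
  rw [mul_sub, mul_div_cancel₀ _ hw.ne', Real.sin_sub]
  apply mul_left_cancel₀ hw.ne'
  have h3 := hX u hu
  have h4 := hY u hu
  linear_combination Real.cos (w * u) * h3 + Real.sin (w * u) * h4 + Real.sin (w * u) * h1 -
    Real.cos (w * u) * h2 - w * g u * Real.sin_sq_add_cos_sq (w * u)

/-- The quantities `(w g ± g₁) exp (∓ w u)` are constants with product `w²R² > 0`, so they have the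
same sign, which is negative because `g` is. The logarithm of their size gives the origin `u₀`. -/
theorem eq_neg_mul_cosh_of_hasDerivAt (hI : IsOpen I) (hI' : I.OrdConnected) (hw : 0 < w)
    (hR : 0 < R) (hne : I.Nonempty)
    (hg : ∀ u ∈ I, HasDerivAt g (g₁ u) u) (hg₁ : ∀ u ∈ I, HasDerivAt g₁ (w ^ 2 * g u) u)
    (hE : ∀ u ∈ I, w ^ 2 * g u ^ 2 - g₁ u ^ 2 = w ^ 2 * R ^ 2) (hneg : ∀ u ∈ I, g u < 0) :
    ∃ u₀, ∀ u ∈ I, g u = -(R * Real.cosh (w * (u - u₀))) := by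
  have hl : ∀ u, HasDerivAt (fun u => w * u) w u := fun u => by
    simpa using (hasDerivAt_id u).const_mul w
  have hexp : ∀ u, Real.exp (w * u) * Real.exp (-(w * u)) = 1 := fun u => by
    rw [← Real.exp_add]
    simp
  obtain ⟨X, hX⟩ := exists_eq_const (f := fun u => (w * g u + g₁ u) * Real.exp (-(w * u))) hI hI' (by
    intro u hu
    refine ((((hg u hu).const_mul w).add (hg₁ u hu)).mul (hl u).neg.exp).congr_deriv ?_
    simp only [Pi.add_apply]
    ring)
  obtain ⟨Y, hY⟩ := exists_eq_const (f := fun u => (w * g u - g₁ u) * Real.exp (w * u)) hI hI' (by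
    intro u hu
    refine ((((hg u hu).const_mul w).sub (hg₁ u hu)).mul (hl u).exp).congr_deriv ?_
    simp only [Pi.sub_apply]
    ring)
  have hXY : X * Y = (w * R) ^ 2 ∧ X < 0 := by
    obtain ⟨u₁, hu₁⟩ := hne
    constructor
    · rw [← hX u₁ hu₁, ← hY u₁ hu₁]
      linear_combination hE u₁ hu₁ + (w ^ 2 * g u₁ ^ 2 - g₁ u₁ ^ 2) * hexp u₁
    · rw [← hX u₁ hu₁]
      refine mul_neg_of_neg_of_pos ?_ (Real.exp_pos _)
      have h1 : 0 < (w * g u₁ + g₁ u₁) * (w * g u₁ - g₁ u₁) := by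
        have : (w * g u₁ + g₁ u₁) * (w * g u₁ - g₁ u₁) = w ^ 2 * R ^ 2 := by
          linear_combination hE u₁ hu₁
        rw [this]
        positivity
      have h2 := mul_neg_of_pos_of_neg hw (hneg u₁ hu₁)
      rcases mul_pos_iff.1 h1 with h3 | h3 <;> linarith [h3.1, h3.2]
  obtain ⟨hXY, hX0⟩ := hXY
  have hwR : 0 < w * R := mul_pos hw hR
  have hq : 0 < -X / (w * R) := div_pos (neg_pos.2 hX0) hwR
  refine ⟨-Real.log (-X / (w * R)) / w, fun u hu => ?_⟩
  rw [mul_sub, mul_div_cancel₀ _ hw.ne', sub_neg_eq_add, Real.cosh_eq, neg_add, Real.exp_add,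
    Real.exp_add, Real.exp_log hq, Real.exp_neg (Real.log _), Real.exp_log hq]
  have h3 := hX u hu
  have h4 := hY u hu
  have hYq : (-X / (w * R))⁻¹ = -Y / (w * R) := by
    rw [inv_div, div_eq_div_iff (neg_pos.2 hX0).ne' hwR.ne']
    linear_combination -hXY
  rw [hYq]
  apply mul_left_cancel₀ hw.ne'
  field_simp
  rw [← h3, ← h4]
  linear_combination (-2 * w * g u) * hexp u

theorem isFlux_of_affine {y g₂ : ℝ → ℝ} {A B : ℝ} (hI : IsOpen I)
    (hy : ∀ u ∈ I, y u = A + B * g u)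
    (hg : ∀ u ∈ I, HasDerivAt g (g₁ u) u) (hg₁ : ∀ u ∈ I, HasDerivAt g₁ (g₂ u) u)
    (h2 : ∀ u ∈ I, B * g₂ u = 2 - 2 * H * k - (H ^ 2 + κ) * y u)
    (hE : ∀ u ∈ I, (B * g₁ u / 2) ^ 2 = y u - κ / 4 * y u ^ 2 - (k + H / 2 * y u) ^ 2) :
    IsFlux κ H k I y := by
  have hd : ∀ u ∈ I, HasDerivAt y (B * g₁ u) u := by
    intro u hu
    refine (((hg u hu).const_mul B).const_add A).congr_of_eventuallyEq ?_
    filter_upwards [hI.mem_nhds hu] with x hx using hy x hx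
  refine ⟨fun u hu => (hd u hu).differentiableAt.hasDerivAt, fun u hu => ?_, fun u hu => ?_⟩
  · rw [← h2 u hu]
    refine ((hg₁ u hu).const_mul B).congr_of_eventuallyEq ?_
    filter_upwards [hI.mem_nhds hu] with x hx using (hd x hx).deriv
  · rw [(hd u hu).deriv, hE u hu]

theorem hasDerivAt_mul_sin (R w u₀ u : ℝ) :
    HasDerivAt (fun u => R * Real.sin (w * (u - u₀))) (R * w * Real.cos (w * (u - u₀))) u ∧
    HasDerivAt (fun u => R * w * Real.cos (w * (u - u₀)))
      (-(w ^ 2 * (R * Real.sin (w * (u - u₀))))) u := by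
  have hl : HasDerivAt (fun u => w * (u - u₀)) w u := by
    simpa using ((hasDerivAt_id u).sub_const u₀).const_mul w
  exact ⟨(hl.sin.const_mul R).congr_deriv (by ring),
    (hl.cos.const_mul (R * w)).congr_deriv (by ring)⟩

theorem hasDerivAt_neg_mul_cosh (R w u₀ u : ℝ) :
    HasDerivAt (fun u => -(R * Real.cosh (w * (u - u₀)))) (-(R * w * Real.sinh (w * (u - u₀)))) u ∧
    HasDerivAt (fun u => -(R * w * Real.sinh (w * (u - u₀))))
      (w ^ 2 * -(R * Real.cosh (w * (u - u₀)))) u := by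
  have hl : HasDerivAt (fun u => w * (u - u₀)) w u := by
    simpa using ((hasDerivAt_id u).sub_const u₀).const_mul w
  exact ⟨(hl.cosh.const_mul R).neg.congr_deriv (by ring),
    (hl.sinh.const_mul (R * w)).neg.congr_deriv (by ring)⟩

/-- The second factor on the right is the discriminant of the energy polynomial `-(H² + κ) y²/4 + (1
- Hk) y - k²`. -/
theorem disc_eq (κ τ a H k : ℝ) :
    disc κ τ a H ((4 * τ ^ 2 - κ) * k - H * (1 - 2 * a * τ)) =
      (4 * τ ^ 2 - κ) ^ 2 * ((1 - H * k) ^ 2 - k ^ 2 * (H ^ 2 + κ)) := by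
  rw [disc, cstB1, cstB]
  ring

/-- For `H² + κ ≠ 0`, this is `(H² + κ)√Δ` at the equilibrium `y = 2(1 - Hk) / (H² + κ)`: `b₁` is
the centre of the oscillation of `S`. -/
theorem cstB1_eq (κ τ a H k : ℝ) :
    cstB1 κ τ a H ((4 * τ ^ 2 - κ) * k - H * (1 - 2 * a * τ)) =
      (H ^ 2 + κ) * (1 - 2 * a * τ) + (4 * τ ^ 2 - κ) * (1 - H * k) := by
  rw [cstB1]
  ring

end BCV

/-! ### From the flux equations to the explicit functions and back. -/

namespace BCV

variable {κ τ a m H k c u₀ : ℝ} {I : Set ℝ} {U g g₁ : ℝ → ℝ}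

theorem IsBourAdmissible.sqrt_delta_pos (hU : IsBourAdmissible κ τ a m I U) {u : ℝ} (hu : u ∈ I) :
    0 < 1 - 2 * a * τ + (4 * τ ^ 2 - κ) / 2 * radial κ τ a m U u := by
  rw [← (hU.sqrt_delta_and_norm hu).1]
  exact Real.sqrt_pos.2 (hU.delta_pos u hu)

/-- For `κ ≠ 4τ²` the function `U²` is a quadratic polynomial in `√Δ`. -/
theorem IsBourAdmissible.sq_eq (hU : IsBourAdmissible κ τ a m I U) {u : ℝ}
    (hu : u ∈ I) : m ^ 2 * (4 * τ ^ 2 - κ) * U u ^ 2 = cstB3 κ τ a +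
      (1 - 2 * a * τ + (4 * τ ^ 2 - κ) / 2 * radial κ τ a m U u) ^ 2 := by
  have h := (hU.sqrt_delta_and_norm hu).2
  rw [cstB3]
  linear_combination (4 * τ ^ 2 - κ) * h

namespace IsFlux

theorem hasDerivAt_affine {y : ℝ → ℝ} (h : IsFlux κ H k I y) (A B : ℝ) :
    (∀ u ∈ I, HasDerivAt (fun u => A + B * y u) (B * deriv y u) u) ∧
    ∀ u ∈ I, HasDerivAt (fun u => B * deriv y u) (B * (2 - 2 * H * k - (H ^ 2 + κ) * y u)) u :=
  ⟨fun u hu => ((h.hasDerivAt u hu).const_mul B).const_add A,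
    fun u hu => (h.hasDerivAt_deriv u hu).const_mul B⟩

/-- Since `√Δ` is affine in `y`, it satisfies a linear equation of the same kind; `c` is the affine
function of `k` that turns its centre and amplitude into `b₁` and `d`. -/
theorem isExplicit_of_ne (h : IsFlux κ H k I (radial κ τ a m U))
    (hU : IsBourAdmissible κ τ a m I U) (hI : IsOpen I) (hI' : I.OrdConnected) (hne : I.Nonempty)
    (hm : m ≠ 0) (hκ : κ ≠ 4 * τ ^ 2) :
    ∃ u₀, IsExplicit κ τ a m H ((4 * τ ^ 2 - κ) * k - H * (1 - 2 * a * τ)) u₀ I U := by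
  have hβ : 4 * τ ^ 2 - κ ≠ 0 := sub_ne_zero.2 hκ.symm
  have hV := fun u hu => hU.sqrt_delta_pos (u := u) hu
  have hsq := fun u hu => hU.sq_eq (u := u) hu
  have hypos := fun u hu => hU.radial_pos (u := u) hu
  rcases eq_or_ne (H ^ 2 + κ) 0 with hμ | hμ
  · -- the parabolic case
    have hκ' : κ = -H ^ 2 := by linear_combination hμ
    -- If `Hk = 1`, the energy equation becomes `(y'/2)² = -k²`, which forces `k = 0`.
    have hHk : H * k ≠ 1 := by
      intro h1
      obtain ⟨u, hu⟩ := hne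
      have h2 := h.energy u hu
      have h3 : (deriv (radial κ τ a m U) u / 2) ^ 2 + k ^ 2 = 0 := by
        linear_combination h2 - radial κ τ a m U u * h1 - radial κ τ a m U u ^ 2 / 4 * hμ
      have h4 : k ^ 2 = 0 := by nlinarith [sq_nonneg (deriv (radial κ τ a m U) u / 2), sq_nonneg k]
      have h5 : k = 0 := pow_eq_zero_iff two_ne_zero |>.1 h4
      rw [h5, mul_zero] at h1
      exact zero_ne_one h1
    have hb1 := cstB1_eq κ τ a H k
    rw [hμ, zero_mul, zero_add] at hb1
    set c := (4 * τ ^ 2 - κ) * k - H * (1 - 2 * a * τ) with hc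
    have hb1' : cstB1 κ τ a H c ≠ 0 := by
      rw [hb1]
      exact mul_ne_zero hβ (sub_ne_zero.2 hHk.symm)
    have hb2 : 2 * cstB1 κ τ a H c * cstB2 κ τ a H c = 2 * cstB1 κ τ a H c * (1 - 2 * a * τ) +
        (4 * τ ^ 2 - κ) ^ 2 * k ^ 2 := by
      rw [cstB2, mul_div_cancel₀ _ (mul_ne_zero two_ne_zero hb1'), hb1, cstB, hc]
      linear_combination (1 - 2 * a * τ) ^ 2 * hμ
    obtain ⟨hd, hd'⟩ := h.hasDerivAt_affine (1 - 2 * a * τ) ((4 * τ ^ 2 - κ) / 2)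
    -- Here `√Δ` has constant second derivative `b₁`, hence slope `b₁ u + C`; the vertex `-C / b₁`
    -- serves as `u₀`.
    obtain ⟨C, hC⟩ := exists_eq_const (f := fun u => (4 * τ ^ 2 - κ) / 2 *
      deriv (radial κ τ a m U) u - cstB1 κ τ a H c * u) hI hI' (by
        intro u hu
        refine ((hd' u hu).sub ((hasDerivAt_id u).const_mul (cstB1 κ τ a H c))).congr_deriv ?_
        rw [hμ, hb1]
        ring)
    have hform : ∀ u ∈ I, cstB1 κ τ a H c / 2 * (u - -C / cstB1 κ τ a H c) ^ 2 + cstB2 κ τ a H c =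
        1 - 2 * a * τ + (4 * τ ^ 2 - κ) / 2 * radial κ τ a m U u := by
      intro u hu
      have h1 := h.energy u hu
      have h2 : cstB1 κ τ a H c * (u - -C / cstB1 κ τ a H c) =
          (4 * τ ^ 2 - κ) / 2 * deriv (radial κ τ a m U) u := by
        rw [mul_sub, mul_div_cancel₀ _ hb1']
        linear_combination -(hC u hu)
      apply mul_left_cancel₀ (mul_ne_zero two_ne_zero hb1')
      rw [mul_add, hb2, hb1] at *
      linear_combination (((4 * τ ^ 2 - κ) * (1 - H * k)) * (u - -C / ((4 * τ ^ 2 - κ) * (1 - H * k))) +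
          (4 * τ ^ 2 - κ) / 2 * deriv (radial κ τ a m U) u) * h2 + (4 * τ ^ 2 - κ) ^ 2 * h1 -
          (4 * τ ^ 2 - κ) ^ 2 / 4 * radial κ τ a m U u ^ 2 * hμ
    refine ⟨-C / cstB1 κ τ a H c, Or.inr (Or.inr (Or.inl ⟨hκ', hκ, hb1', fun u hu => ?_⟩))⟩
    rw [hform u hu]
    refine ⟨hV u hu, ?_⟩
    have hβ' : 4 * τ ^ 2 + H ^ 2 = 4 * τ ^ 2 - κ := by linear_combination hμ
    rw [hβ', eq_div_iff (mul_ne_zero (pow_ne_zero 2 hm) hβ)]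
    linear_combination hsq u hu
  · have hd := disc_eq κ τ a H k
    have hb1 := cstB1_eq κ τ a H k
    set c := (4 * τ ^ 2 - κ) * k - H * (1 - 2 * a * τ) with hc
    -- The oscillator is `g = (H² + κ)√Δ - b₁`, with `g'' = -(H² + κ) g`.
    obtain ⟨hg, hg'⟩ := h.hasDerivAt_affine ((H ^ 2 + κ) * (1 - 2 * a * τ) - cstB1 κ τ a H c)
      ((H ^ 2 + κ) * (4 * τ ^ 2 - κ) / 2)
    have hode : ∀ u, (H ^ 2 + κ) * (4 * τ ^ 2 - κ) / 2 * (2 - 2 * H * k - (H ^ 2 + κ) *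
        radial κ τ a m U u) = -((H ^ 2 + κ) * ((H ^ 2 + κ) * (1 - 2 * a * τ) - cstB1 κ τ a H c +
          (H ^ 2 + κ) * (4 * τ ^ 2 - κ) / 2 * radial κ τ a m U u)) := by
      intro u
      rw [hb1]
      ring
    simp only [hode] at hg'
    have hE : ∀ u ∈ I, ((H ^ 2 + κ) * (4 * τ ^ 2 - κ) / 2 * deriv (radial κ τ a m U) u) ^ 2 +
        (H ^ 2 + κ) * ((H ^ 2 + κ) * (1 - 2 * a * τ) - cstB1 κ τ a H c +
          (H ^ 2 + κ) * (4 * τ ^ 2 - κ) / 2 * radial κ τ a m U u) ^ 2 =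
        (H ^ 2 + κ) * disc κ τ a H c := by
      intro u hu
      rw [hb1, hd]
      linear_combination ((H ^ 2 + κ) * (4 * τ ^ 2 - κ)) ^ 2 * h.energy u hu
    have hU2 : ∀ u ∈ I, U u ^ 2 = ((H ^ 2 + κ) ^ 2 * cstB3 κ τ a + ((H ^ 2 + κ) *
        (1 - 2 * a * τ + (4 * τ ^ 2 - κ) / 2 * radial κ τ a m U u)) ^ 2) /
        (m ^ 2 * (4 * τ ^ 2 - κ) * (H ^ 2 + κ) ^ 2) := by
      intro u hu
      rw [eq_div_iff (mul_ne_zero (mul_ne_zero (pow_ne_zero 2 hm) hβ) (pow_ne_zero 2 hμ))]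
      linear_combination (H ^ 2 + κ) ^ 2 * hsq u hu
    rcases lt_or_gt_of_ne hμ with hneg | hpos
    · have hβpos : 0 < 4 * τ ^ 2 - κ := by nlinarith [sq_nonneg H, sq_nonneg τ]
      have hdpos : 0 < disc κ τ a H c := by
        rw [hd]
        refine mul_pos (pow_pos hβpos 2) ?_
        rcases eq_or_ne k 0 with rfl | hk
        · simp
        · have : 0 < k ^ 2 * -(H ^ 2 + κ) := mul_pos (by positivity) (neg_pos.2 hneg)
          nlinarith [sq_nonneg (1 - H * k)]
      have hw2 : √(-(H ^ 2 + κ)) ^ 2 = -(H ^ 2 + κ) := Real.sq_sqrt (neg_pos.2 hneg).le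
      have hR2 : √(disc κ τ a H c) ^ 2 = disc κ τ a H c := Real.sq_sqrt hdpos.le
      obtain ⟨u₀, hu₀⟩ := eq_neg_mul_cosh_of_hasDerivAt hI hI' (Real.sqrt_pos.2 (neg_pos.2 hneg))
        (Real.sqrt_pos.2 hdpos) hne hg (fun u hu => (hg' u hu).congr_deriv (by rw [hw2]; ring))
        (fun u hu => by
          rw [hw2, hR2]
          linear_combination -hE u hu) (by
        intro u hu
        -- The energy and `y > 0` give `1 - Hk ≥ (H² + κ) y/4`, which exceeds `(H² + κ) y/2`; hence
        -- `g < 0` and the lower branch of the hyperbolic cosine occurs.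
        have h1 := h.energy u hu
        have hy := hypos u hu
        have h2 : 0 ≤ radial κ τ a m U u * ((1 - H * k) - (H ^ 2 + κ) / 4 * radial κ τ a m U u) := by
          have : radial κ τ a m U u * ((1 - H * k) - (H ^ 2 + κ) / 4 * radial κ τ a m U u) =
              (deriv (radial κ τ a m U) u / 2) ^ 2 + k ^ 2 := by
            linear_combination -h1
          rw [this]
          positivity
        have h3 := nonneg_of_mul_nonneg_right h2 hy
        have h4 := mul_pos (neg_pos.2 hneg) hy
        have h5 : 0 < (4 * τ ^ 2 - κ) * ((1 - H * k) - (H ^ 2 + κ) / 2 * radial κ τ a m U u) :=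
          mul_pos hβpos (by linarith)
        rw [hb1]
        linarith)
      refine ⟨u₀, Or.inr (Or.inr (Or.inr (Or.inr (Or.inr ⟨by linarith, hκ, hdpos,
        fun u hu => ?_⟩))))⟩
      have e : cstB1 κ τ a H c - √(disc κ τ a H c) * Real.cosh (√(-(H ^ 2 + κ)) * (u - u₀)) =
          (H ^ 2 + κ) * (1 - 2 * a * τ + (4 * τ ^ 2 - κ) / 2 * radial κ τ a m U u) := by
        linear_combination -hu₀ u hu
      rw [e]
      exact ⟨mul_neg_of_neg_of_pos hneg (hV u hu), hU2 u hu⟩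
    · have hd0 : 0 ≤ disc κ τ a H c := by
        obtain ⟨u, hu⟩ := hne
        refine nonneg_of_mul_nonneg_right ?_ hpos
        rw [← hE u hu]
        positivity
      have hw2 : √(H ^ 2 + κ) ^ 2 = H ^ 2 + κ := Real.sq_sqrt hpos.le
      have hR2 : √(disc κ τ a H c) ^ 2 = disc κ τ a H c := Real.sq_sqrt hd0
      obtain ⟨u₀, hu₀⟩ := eq_mul_sin_of_hasDerivAt hI hI' (Real.sqrt_pos.2 hpos)
        (Real.sqrt_nonneg (disc κ τ a H c)) hne hg
        (fun u hu => (hg' u hu).congr_deriv (by rw [hw2]))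
        (fun u hu => by
          rw [hw2, hR2]
          exact hE u hu)
      refine ⟨u₀, Or.inr (Or.inr (Or.inr (Or.inl ⟨by linarith, hκ, hd0, fun u hu => ?_⟩)))⟩
      have e : cstB1 κ τ a H c + √(disc κ τ a H c) * Real.sin (√(H ^ 2 + κ) * (u - u₀)) =
          (H ^ 2 + κ) * (1 - 2 * a * τ + (4 * τ ^ 2 - κ) / 2 * radial κ τ a m U u) := by
        linear_combination -hu₀ u hu
      rw [e]
      exact ⟨mul_pos hpos (hV u hu), hU2 u hu⟩

/-- For `κ = 4τ²`, `√Δ` is the constant `1 - 2aτ` and carries no information, but `m²U² = a² + (1 -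
2aτ) y` is itself affine in `y`. This accounts for the different relation between `c` and `k`. -/
theorem isExplicit_of_eq (h : IsFlux κ H k I (radial κ τ a m U))
    (hU : IsBourAdmissible κ τ a m I U) (hI : IsOpen I) (hI' : I.OrdConnected) (hne : I.Nonempty)
    (hm : m ≠ 0) (hκ : κ = 4 * τ ^ 2) :
    ∃ u₀, IsExplicit κ τ a m H (2 * (1 - 2 * a * τ) * k - a ^ 2 * H) u₀ I U := by
  have hsq := fun u hu => (hU.sqrt_delta_and_norm (u := u) hu).2
  subst hκ
  rcases eq_or_ne (H ^ 2 + 4 * τ ^ 2) 0 with hμ | hμ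
  · have hτ : τ = 0 := by nlinarith [sq_nonneg H, sq_nonneg τ]
    have hH : H = 0 := by nlinarith [sq_nonneg H, sq_nonneg τ]
    subst hτ hH
    obtain ⟨C, hC⟩ := exists_eq_const (f := fun u =>
      deriv (radial (4 * 0 ^ 2) 0 a m U) u - 2 * u) hI hI' (by
        intro u hu
        refine ((h.hasDerivAt_deriv u hu).sub ((hasDerivAt_id u).const_mul 2)).congr_deriv ?_
        ring)
    refine ⟨-C / 2, Or.inl ⟨by norm_num, rfl, rfl, fun u hu => ?_⟩⟩
    rw [eq_div_iff (pow_ne_zero 2 hm)]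
    have h1 := h.energy u hu
    have h2 : deriv (radial (4 * 0 ^ 2) 0 a m U) u = 2 * (u - -C / 2) := by
      linear_combination hC u hu
    rw [h2] at h1
    linear_combination hsq u hu - h1
  · have hpos : 0 < H ^ 2 + 4 * τ ^ 2 := lt_of_le_of_ne (by positivity) hμ.symm
    have hcc : cstC1 τ a H (2 * (1 - 2 * a * τ) * k - a ^ 2 * H) ^ 2 +
        cstC2 τ a (2 * (1 - 2 * a * τ) * k - a ^ 2 * H) * (H ^ 2 + 4 * τ ^ 2) =
        4 * (1 - 2 * a * τ) ^ 2 * ((1 - H * k) ^ 2 - k ^ 2 * (H ^ 2 + 4 * τ ^ 2)) := by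
      rw [cstC1, cstC2]
      ring
    have hc1 : cstC1 τ a H (2 * (1 - 2 * a * τ) * k - a ^ 2 * H) =
        a ^ 2 * (H ^ 2 + 4 * τ ^ 2) + 2 * (1 - 2 * a * τ) * (1 - H * k) := by
      rw [cstC1]
      ring
    set c := 2 * (1 - 2 * a * τ) * k - a ^ 2 * H with hc
    -- This affine function is `m²(H² + 4τ²)U² - c₁`.
    obtain ⟨hg, hg'⟩ := h.hasDerivAt_affine (-(2 * (1 - 2 * a * τ) * (1 - H * k)))
      ((1 - 2 * a * τ) * (H ^ 2 + 4 * τ ^ 2))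
    have hE : ∀ u ∈ I, ((1 - 2 * a * τ) * (H ^ 2 + 4 * τ ^ 2) *
        deriv (radial (4 * τ ^ 2) τ a m U) u) ^ 2 + (H ^ 2 + 4 * τ ^ 2) *
        (-(2 * (1 - 2 * a * τ) * (1 - H * k)) +
          (1 - 2 * a * τ) * (H ^ 2 + 4 * τ ^ 2) * radial (4 * τ ^ 2) τ a m U u) ^ 2 =
        (H ^ 2 + 4 * τ ^ 2) * (cstC1 τ a H c ^ 2 + cstC2 τ a c * (H ^ 2 + 4 * τ ^ 2)) := by
      intro u hu
      rw [hcc]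
      linear_combination 4 * ((1 - 2 * a * τ) * (H ^ 2 + 4 * τ ^ 2)) ^ 2 * h.energy u hu
    have hd0 : 0 ≤ cstC1 τ a H c ^ 2 + cstC2 τ a c * (H ^ 2 + 4 * τ ^ 2) := by
      obtain ⟨u, hu⟩ := hne
      refine nonneg_of_mul_nonneg_right ?_ hpos
      rw [← hE u hu]
      positivity
    have hw2 : √(4 * τ ^ 2 + H ^ 2) ^ 2 = H ^ 2 + 4 * τ ^ 2 := by
      rw [Real.sq_sqrt (by positivity)]
      ring
    have hR2 := Real.sq_sqrt hd0
    obtain ⟨u₀, hu₀⟩ := eq_mul_sin_of_hasDerivAt (w := √(4 * τ ^ 2 + H ^ 2)) hI hI'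
      (Real.sqrt_pos.2 (by linarith))
      (Real.sqrt_nonneg (cstC1 τ a H c ^ 2 + cstC2 τ a c * (H ^ 2 + 4 * τ ^ 2))) hne hg
      (fun u hu => (hg' u hu).congr_deriv (by rw [hw2]; ring))
      (fun u hu => by
        rw [hw2, hR2]
        exact hE u hu)
    refine ⟨u₀, Or.inr (Or.inl ⟨rfl, fun h0 => hμ (by linarith), hd0, fun u hu => ?_⟩)⟩
    rw [eq_div_iff (mul_ne_zero (pow_ne_zero 2 hm) hμ), ← hu₀ u hu, hc1]
    linear_combination (H ^ 2 + 4 * τ ^ 2) * hsq u hu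

theorem exists_isExplicit (h : IsFlux κ H k I (radial κ τ a m U))
    (hU : IsBourAdmissible κ τ a m I U) (hI : IsOpen I) (hI' : I.OrdConnected) (hne : I.Nonempty)
    (hm : m ≠ 0) : ∃ c u₀, IsExplicit κ τ a m H c u₀ I U := by
  rcases eq_or_ne κ (4 * τ ^ 2) with hκ | hκ
  · exact ⟨_, h.isExplicit_of_eq hU hI hI' hne hm hκ⟩
  · exact ⟨_, h.isExplicit_of_ne hU hI hI' hne hm hκ⟩

end IsFlux

/-- If `√Δ` is an affine function of `g` and `g` solves the equation of the (possibly hyperbolic)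
oscillator with the right energy, then the flux equations hold. -/
theorem IsBourAdmissible.isFlux_of_oscillator (hU : IsBourAdmissible κ τ a m I U) (hI : IsOpen I)
    (hm : m ≠ 0) (hκ : κ ≠ 4 * τ ^ 2) (hμ : H ^ 2 + κ ≠ 0)
    (hg : ∀ u ∈ I, HasDerivAt g (g₁ u) u)
    (hg₁ : ∀ u ∈ I, HasDerivAt g₁ (-((H ^ 2 + κ) * g u)) u)
    (hE : ∀ u ∈ I, g₁ u ^ 2 = (H ^ 2 + κ) * (disc κ τ a H c - g u ^ 2))
    (hV : ∀ u ∈ I, 0 < (cstB1 κ τ a H c + g u) / (H ^ 2 + κ))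
    (hU2 : ∀ u ∈ I, U u ^ 2 = ((H ^ 2 + κ) ^ 2 * cstB3 κ τ a + (cstB1 κ τ a H c + g u) ^ 2) /
      (m ^ 2 * (4 * τ ^ 2 - κ) * (H ^ 2 + κ) ^ 2)) :
    ∃ k, IsFlux κ H k I (radial κ τ a m U) := by
  have hβ : 4 * τ ^ 2 - κ ≠ 0 := sub_ne_zero.2 hκ.symm
  obtain ⟨k, hk⟩ : ∃ k, (4 * τ ^ 2 - κ) * k - H * (1 - 2 * a * τ) = c :=
    ⟨(c + H * (1 - 2 * a * τ)) / (4 * τ ^ 2 - κ), by rw [mul_div_cancel₀ _ hβ]; ring⟩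
  have hd := disc_eq κ τ a H k
  have hb1 := cstB1_eq κ τ a H k
  rw [hk] at hd hb1
  -- The formula for `U²` fixes only the square of the left side; the sign hypothesis identifies it
  -- with `√Δ`.
  have hy : ∀ u ∈ I, (cstB1 κ τ a H c + g u) / (H ^ 2 + κ) =
      1 - 2 * a * τ + (4 * τ ^ 2 - κ) / 2 * radial κ τ a m U u := by
    intro u hu
    refine (sq_eq_sq₀ (hV u hu).le (hU.sqrt_delta_pos hu).le).1 ?_
    have h1 := hU.sq_eq hu
    have h2 := hU2 u hu
    rw [eq_div_iff (mul_ne_zero (mul_ne_zero (pow_ne_zero 2 hm) hβ) (pow_ne_zero 2 hμ))] at h2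
    rw [div_pow, div_eq_iff (pow_ne_zero 2 hμ)]
    linear_combination (H ^ 2 + κ) ^ 2 * h1 - h2
  have hy' : ∀ u ∈ I, g u = (H ^ 2 + κ) * (1 - 2 * a * τ +
      (4 * τ ^ 2 - κ) / 2 * radial κ τ a m U u) - cstB1 κ τ a H c := by
    intro u hu
    rw [← hy u hu, mul_div_cancel₀ _ hμ]
    ring
  -- `A` and `B` come from solving the identity `hy` for `y`.
  refine ⟨k, isFlux_of_affine
    (A := 2 / (4 * τ ^ 2 - κ) * (cstB1 κ τ a H c / (H ^ 2 + κ) - (1 - 2 * a * τ)))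
    (B := 2 / ((4 * τ ^ 2 - κ) * (H ^ 2 + κ))) hI (fun u hu => ?_) hg hg₁
    (fun u hu => ?_) (fun u hu => ?_)⟩
  · rw [hy' u hu]
    field_simp
    ring
  · rw [hy' u hu, hb1]
    field_simp
    ring
  · have h1 := hE u hu
    rw [hy' u hu, hb1, hd] at h1
    have e : (2 / ((4 * τ ^ 2 - κ) * (H ^ 2 + κ)) * g₁ u / 2) ^ 2 =
        g₁ u ^ 2 / ((4 * τ ^ 2 - κ) * (H ^ 2 + κ)) ^ 2 := by
      field_simp
    rw [e, div_eq_iff (pow_ne_zero 2 (mul_ne_zero hβ hμ)), h1]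
    ring

/-- The explicit functions satisfy the flux equations. -/
theorem IsExplicit.exists_isFlux (h : IsExplicit κ τ a m H c u₀ I U)
    (hU : IsBourAdmissible κ τ a m I U) (hI : IsOpen I) (hne : I.Nonempty) (hm : m ≠ 0) :
    ∃ k, IsFlux κ H k I (radial κ τ a m U) := by
  have hsq := fun u hu => (hU.sqrt_delta_and_norm (u := u) hu).2
  have hlin : ∀ u : ℝ, HasDerivAt (fun u => u - u₀) 1 u := fun u => (hasDerivAt_id u).sub_const u₀
  rcases h with ⟨hκ, hτ, hH, h⟩ | ⟨hκ, hμ, hd, h⟩ | ⟨hμ, hκ, hb1, h⟩ | ⟨hμ, hκ, hd, h⟩ |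
    ⟨hμ, hκ, hd, h⟩ | ⟨hμ, hκ, hd, h⟩
  · subst hκ hτ hH
    have hy : ∀ u ∈ I, radial 0 0 a m U u = c ^ 2 / 4 + 1 * (u - u₀) ^ 2 := by
      intro u hu
      have h1 := h u hu
      rw [eq_div_iff (pow_ne_zero 2 hm)] at h1
      linear_combination h1 - hsq u hu
    refine ⟨c / 2, isFlux_of_affine hI hy (g₁ := fun u => 2 * (u - u₀)) (g₂ := fun _ => 2)
      (fun u _ => ((hlin u).pow 2).congr_deriv (by norm_num))
      (fun u _ => ((hlin u).const_mul 2).congr_deriv (by norm_num))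
      (fun u _ => by ring) (fun u hu => ?_)⟩
    rw [hy u hu]
    ring
  · subst hκ
    have hpos : 0 < H ^ 2 + 4 * τ ^ 2 := by
      refine lt_of_le_of_ne (by positivity) fun h0 => hμ ?_
      linarith
    -- For `κ = 4τ²` this number is `√Δ`, so the relation between `c` and `k` can be inverted.
    have hα : 0 < 1 - 2 * a * τ := by
      obtain ⟨u, hu⟩ := hne
      simpa using hU.sqrt_delta_pos hu
    have hw2 : √(4 * τ ^ 2 + H ^ 2) ^ 2 = H ^ 2 + 4 * τ ^ 2 := by
      rw [Real.sq_sqrt (by positivity)]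
      ring
    have hR2 := Real.sq_sqrt hd
    obtain ⟨k, hk⟩ : ∃ k, c = 2 * (1 - 2 * a * τ) * k - a ^ 2 * H :=
      ⟨(c + a ^ 2 * H) / (2 * (1 - 2 * a * τ)), by field_simp; ring⟩
    have hcc : cstC1 τ a H c ^ 2 + cstC2 τ a c * (H ^ 2 + 4 * τ ^ 2) =
        4 * (1 - 2 * a * τ) ^ 2 * ((1 - H * k) ^ 2 - k ^ 2 * (H ^ 2 + 4 * τ ^ 2)) := by
      rw [cstC1, cstC2, hk]
      ring
    have hc1 : cstC1 τ a H c =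
        a ^ 2 * (H ^ 2 + 4 * τ ^ 2) + 2 * (1 - 2 * a * τ) * (1 - H * k) := by
      rw [cstC1, hk]
      ring
    set R := √(cstC1 τ a H c ^ 2 + cstC2 τ a c * (H ^ 2 + 4 * τ ^ 2))
    set w := √(4 * τ ^ 2 + H ^ 2)
    have hy : ∀ u ∈ I, R * Real.sin (w * (u - u₀)) = (1 - 2 * a * τ) * ((H ^ 2 + 4 * τ ^ 2) *
        radial (4 * τ ^ 2) τ a m U u - 2 * (1 - H * k)) := by
      intro u hu
      have h1 := h u hu
      rw [eq_div_iff (mul_ne_zero (pow_ne_zero 2 hm) hpos.ne'), hc1] at h1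
      linear_combination (H ^ 2 + 4 * τ ^ 2) * hsq u hu - h1
    refine ⟨k, isFlux_of_affine (A := 2 * (1 - H * k) / (H ^ 2 + 4 * τ ^ 2))
      (B := 1 / ((1 - 2 * a * τ) * (H ^ 2 + 4 * τ ^ 2))) hI
      (fun u hu => ?_) (fun u _ => (hasDerivAt_mul_sin R w u₀ u).1)
      (fun u _ => (hasDerivAt_mul_sin R w u₀ u).2) (fun u hu => ?_) (fun u hu => ?_)⟩
    · have e : ∀ α μ D y : ℝ, α ≠ 0 → μ ≠ 0 → y = D / μ + 1 / (α * μ) * (α * (μ * y - D)) := by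
        intro α μ D y hα hμ
        field_simp
        ring
      rw [hy u hu]
      exact e _ _ _ _ hα.ne' hpos.ne'
    · have e : ∀ α μ D y : ℝ, α ≠ 0 → μ ≠ 0 →
          1 / (α * μ) * -(μ * (α * (μ * y - D))) = D - μ * y := by
        intro α μ D y hα hμ
        field_simp
        ring
      rw [hy u hu, hw2, e _ _ _ _ hα.ne' hpos.ne']
      ring
    · have e : ∀ X Y : ℝ, (1 / X * Y / 2) ^ 2 = Y ^ 2 / (4 * X ^ 2) := by
        intro X Y
        ring
      have h1 : (R * w * Real.cos (w * (u - u₀))) ^ 2 =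
          w ^ 2 * (R ^ 2 - (R * Real.sin (w * (u - u₀))) ^ 2) := by
        linear_combination R ^ 2 * w ^ 2 * Real.sin_sq_add_cos_sq (w * (u - u₀))
      rw [hcc] at hR2
      rw [e, div_eq_iff (by positivity), h1, hw2, hR2, hy u hu]
      ring
  · have hβ : 4 * τ ^ 2 - κ ≠ 0 := sub_ne_zero.2 hκ.symm
    have hμ0 : H ^ 2 + κ = 0 := by rw [hμ]; ring
    obtain ⟨k, hk⟩ : ∃ k, (4 * τ ^ 2 - κ) * k - H * (1 - 2 * a * τ) = c :=
      ⟨(c + H * (1 - 2 * a * τ)) / (4 * τ ^ 2 - κ), by rw [mul_div_cancel₀ _ hβ]; ring⟩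
    have hb1e := cstB1_eq κ τ a H k
    rw [hk, hμ0, zero_mul, zero_add] at hb1e
    have hb2 : 2 * cstB1 κ τ a H c * cstB2 κ τ a H c = 2 * cstB1 κ τ a H c * (1 - 2 * a * τ) +
        (4 * τ ^ 2 - κ) ^ 2 * k ^ 2 := by
      rw [cstB2, mul_div_cancel₀ _ (mul_ne_zero two_ne_zero hb1), hb1e, cstB, ← hk]
      linear_combination (1 - 2 * a * τ) ^ 2 * hμ0
    have hy : ∀ u ∈ I, cstB1 κ τ a H c / 2 * (u - u₀) ^ 2 + cstB2 κ τ a H c =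
        1 - 2 * a * τ + (4 * τ ^ 2 - κ) / 2 * radial κ τ a m U u := by
      intro u hu
      obtain ⟨h1, h2⟩ := h u hu
      refine (sq_eq_sq₀ h1.le (hU.sqrt_delta_pos hu).le).1 ?_
      have h3 := hU.sq_eq hu
      have hβ' : 4 * τ ^ 2 + H ^ 2 = 4 * τ ^ 2 - κ := by linear_combination hμ0
      rw [hβ', eq_div_iff (mul_ne_zero (pow_ne_zero 2 hm) hβ)] at h2
      linear_combination h3 - h2
    refine ⟨k, isFlux_of_affine (A := 2 / (4 * τ ^ 2 - κ) * (cstB2 κ τ a H c - (1 - 2 * a * τ)))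
      (B := 1 - H * k) (g := fun u => (u - u₀) ^ 2) (g₁ := fun u => 2 * (u - u₀))
      (g₂ := fun _ => 2) hI (fun u hu => ?_)
      (fun u _ => ((hlin u).pow 2).congr_deriv (by norm_num))
      (fun u _ => ((hlin u).const_mul 2).congr_deriv (by norm_num)) (fun u hu => ?_)
      (fun u hu => ?_)⟩
    · have h1 := hy u hu
      rw [hb1e] at h1
      field_simp
      linear_combination -2 * h1
    · rw [hμ0]
      ring
    · have h1 := hy u hu
      apply mul_left_cancel₀ (pow_ne_zero 2 hβ)
      rw [hb1e] at hb2 h1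
      linear_combination 2 * (4 * τ ^ 2 - κ) * (1 - H * k) * h1 - hb2 +
        (4 * τ ^ 2 - κ) ^ 2 / 4 * radial κ τ a m U u ^ 2 * hμ0
  · have hpos : 0 < H ^ 2 + κ := by linarith
    have hw2 : √(H ^ 2 + κ) ^ 2 = H ^ 2 + κ := Real.sq_sqrt hpos.le
    have hR2 := Real.sq_sqrt hd
    refine hU.isFlux_of_oscillator hI hm hκ hpos.ne' (c := c)
      (fun u _ => (hasDerivAt_mul_sin (√(disc κ τ a H c)) (√(H ^ 2 + κ)) u₀ u).1)
      (fun u _ => ((hasDerivAt_mul_sin (√(disc κ τ a H c)) (√(H ^ 2 + κ)) u₀ u).2).congr_deriv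
        (by rw [hw2])) (fun u _ => ?_) (fun u hu => div_pos (h u hu).1 hpos) (fun u hu => (h u hu).2)
    rw [mul_pow, mul_pow, mul_pow, hw2, hR2, Real.cos_sq']
    ring
  -- The hyperbolic sine case is empty: by `disc_eq`, `H² + κ < 0` forces `d ≥ 0`.
  · exfalso
    have hβ : 4 * τ ^ 2 - κ ≠ 0 := sub_ne_zero.2 hκ.symm
    obtain ⟨k, hk⟩ : ∃ k, (4 * τ ^ 2 - κ) * k - H * (1 - 2 * a * τ) = c :=
      ⟨(c + H * (1 - 2 * a * τ)) / (4 * τ ^ 2 - κ), by rw [mul_div_cancel₀ _ hβ]; ring⟩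
    have hd' := disc_eq κ τ a H k
    rw [hk] at hd'
    have h1 : 0 ≤ k ^ 2 * -(H ^ 2 + κ) := mul_nonneg (sq_nonneg k) (by linarith)
    have h2 : 0 ≤ (4 * τ ^ 2 - κ) ^ 2 * ((1 - H * k) ^ 2 - k ^ 2 * (H ^ 2 + κ)) :=
      mul_nonneg (sq_nonneg _) (by linarith [sq_nonneg (1 - H * k)])
    linarith
  · have hneg : H ^ 2 + κ < 0 := by linarith
    have hw2 : √(-(H ^ 2 + κ)) ^ 2 = -(H ^ 2 + κ) := Real.sq_sqrt (neg_pos.2 hneg).le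
    have hR2 := Real.sq_sqrt hd.le
    refine hU.isFlux_of_oscillator hI hm hκ hneg.ne (c := c)
      (fun u _ => (hasDerivAt_neg_mul_cosh (√(disc κ τ a H c)) (√(-(H ^ 2 + κ))) u₀ u).1)
      (fun u _ => ((hasDerivAt_neg_mul_cosh (√(disc κ τ a H c)) (√(-(H ^ 2 + κ)))
        u₀ u).2).congr_deriv (by rw [hw2]; ring)) (fun u _ => ?_)
      (fun u hu => div_pos_of_neg_of_neg (h u hu).1 hneg) (fun u hu => (h u hu).2)
    rw [neg_sq, neg_sq, mul_pow, mul_pow, mul_pow, hw2, hR2, Real.sinh_sq]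
    ring

end BCV

end

/-- The first part holds for every branch `ρ` of the square root in the Bour formulas; there the two
signs of `H` correspond to the two unit normals.  The second part says that for each `c` the
explicit function gives a surface of mean curvature exactly `H`. -/
theorem theorem4p3 (κ τ a m H : ℝ) (hm : m ≠ 0)
    (I : Set ℝ) (hI : IsOpen I) (hI' : I.OrdConnected) (hne : I.Nonempty)
    (U : ℝ → ℝ) (hU : BCV.IsBourAdmissible κ τ a m I U) :
    (∀ ρ ξ₂ ϑ : ℝ → ℝ, BCV.IsBourProfile κ τ a m I U ρ ξ₂ ϑ →
      ((BCV.HasMeanCurvature κ τ (BCV.bourSurface κ τ a m U ξ₂ ϑ) I H ∨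
          BCV.HasMeanCurvature κ τ (BCV.bourSurface κ τ a m U ξ₂ ϑ) I (-H)) ↔
        ∃ c u₀ : ℝ, BCV.IsExplicit κ τ a m H c u₀ I U)) ∧
    (∀ c u₀ : ℝ, BCV.IsExplicit κ τ a m H c u₀ I U →
      ∃ ρ ξ₂ ϑ : ℝ → ℝ, BCV.IsBourProfile κ τ a m I U ρ ξ₂ ϑ ∧
        BCV.HasMeanCurvature κ τ (BCV.bourSurface κ τ a m U ξ₂ ϑ) I H) := by
  refine ⟨fun ρ ξ₂ ϑ hprof => ⟨?_, ?_⟩, ?_⟩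
  · rintro (hH | hH)
    · obtain ⟨k, hk⟩ := hprof.exists_isFlux hU hI hI' hm hH
      exact hk.exists_isExplicit hU hI hI' hne hm
    · obtain ⟨k, hk⟩ := hprof.exists_isFlux hU hI hI' hm hH
      -- Mean curvature `-H` with flux `k` satisfies the equations for `H` with flux `-k`, so the
      -- same family of functions results.
      exact hk.neg.exists_isExplicit hU hI hI' hne hm
  · rintro ⟨c, u₀, h⟩
    obtain ⟨k, hk⟩ := h.exists_isFlux hU hI hne hm
    exact hk.hasMeanCurvature_or hprof hU hI hI' hm
  · intro c u₀ h
    obtain ⟨k, hk⟩ := h.exists_isFlux hU hI hne hm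
    exact hk.exists_isBourProfile hU hI hI' hne hm
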